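/- Let $S$ be a finite set with a total order $<$, let $\{\ell_i\}_{i\in S}$ be distinct odd primes, let $M\ge 1$ be an integer dividing $\ell_i-1$ for every $i\in S$, and put $r=\prod_{i\in S}\ell_i$ and $G_S=\mathrm{Gal}(\mathbb{Q}(\mu_r)/\mathbb{Q})$. For $i\in S$ let $G_i\subseteq G_S$ be the inertia subgroup at $\ell_i$, and for $T\subseteq S$ let $G_T=\prod_{i\in T}G_i\subseteq G_S$ be the subgroup generated by the $G_i$, $i\in T$. Let $R=\mathbb{Z}_{\ge 0}[S]$ be the set of families $e=(e_i)_{i\in S}$ of non-negative integers, and for $e,e'\in R$ put $\deg e=\sum_i e_i$, $\operatorname{supp} e=\{i: e_i\neq 0\}$ and $\omega(e,e')=\sum_{j<i}e'_j e_i$. Let $G_S$ act trivially on $\mathbb{Z}/M$. Then there is a family of classes $[e]\in H^*(G_S,\mathbb{Z}/M)$, $e\in R$, such that: 1. For every $T\subseteq S$ and every $n\ge 0$, the restrictions to $G_T$ of the classes $[e]$ with $\operatorname{supp} e\subseteq T$ and $\deg e=n$ lie in $H^n(G_T,\mathbb{Z}/M)$ and form a $\mathbb{Z}/M$-basis of it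 (indexed by these $e$). 2. For every $T\subseteq S$ and every $e\in R$ with $\operatorname{supp} e\not\subseteq T$, the restriction of $[e]$ to $H^*(G_T,\mathbb{Z}/M)$ is zero. 3. For all $e,e'\in R$ one has, in $H^*(G_S,\mathbb{Z}/M)$ and, after restriction, in $H^*(G_T,\mathbb{Z}/M)$ for every $T\subseteq S$, $$[e]\cup[e']=(-1)^{\omega(e,e')}\prod_{\substack{i\in S\\ e_ie'_i\ \mathrm{odd}}}\frac{\ell_i-1}{2}\;[e+e'].$$ -/

import Mathlib

open CategoryTheory

noncomputable section

namespace CupProduct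

/-- The `n`-th cohomology group `Hⁿ(G, k)` of a group `G` with coefficients in a commutative ring
`k` on which `G` acts trivially. -/
abbrev H (k G : Type) [CommRing k] [Group G] (n : ℕ) : ModuleCat k :=
  groupCohomology (Rep.trivial k G k) n

/-- The total cohomology `H^*(G, k) = ⨁ₙ Hⁿ(G, k)`. -/
abbrev HStar (k G : Type) [CommRing k] [Group G] : Type :=
  DirectSum ℕ (fun n => H k G n)

section Restriction

variable (k : Type) [CommRing k] {G : Type} [Group G]

/-- The restriction map `Hⁿ(G, k) → Hⁿ(K, k)` to a subgroup `K` of `G`. -/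
def res (K : Subgroup G) (n : ℕ) : H k G n →ₗ[k] H k K n :=
  (groupCohomology.map (A := Rep.trivial k G k) (B := Rep.trivial k K k) K.subtype
    (Rep.ofHom ⟨LinearMap.id, fun _ => rfl⟩) n).hom

/-- The restriction map `H^*(G, k) → H^*(K, k)` to a subgroup `K` of `G`. -/
def resStar (K : Subgroup G) : HStar k G →ₗ[k] HStar k K :=
  DirectSum.lmap (fun n => res k K n)

end Restriction

section Cochains

variable {k G : Type} [CommRing k]

/-- The cup product of inhomogeneous cochains with values in the ring `k` with trivial action:
`(f ∪ g)(x₁, …, x_{p+q}) = f(x₁, …, x_p) g(x_{p+1}, …, x_{p+q})`. -/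
def cupC {p q n : ℕ} (h : p + q = n) :
    ((Fin p → G) → k) →ₗ[k] ((Fin q → G) → k) →ₗ[k] ((Fin n → G) → k) :=
  LinearMap.mk₂ k
    (fun f g x => f (fun i => x ⟨i, by omega⟩) * g (fun j => x ⟨p + j, by omega⟩))
    (fun _ _ _ => by ext; simp [add_mul])
    (fun _ _ _ => by ext; simp [mul_assoc])
    (fun _ _ _ => by ext; simp [mul_add])
    (fun _ _ _ => by ext; simp [mul_left_comm])

theorem cupC_apply {p q n : ℕ} (h : p + q = n) (f : (Fin p → G) → k) (g : (Fin q → G) → k)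
    (x : Fin n → G) :
    cupC h f g x = f (fun i => x ⟨i, by omega⟩) * g (fun j => x ⟨p + j, by omega⟩) := rfl

end Cochains

section Cup

variable {k G : Type} [CommRing k] [Group G]

/-- The differential of the complex of inhomogeneous cochains of `G` with values in `k`. -/
def dC (k G : Type) [CommRing k] [Group G] (n : ℕ) :
    ((Fin n → G) → k) →ₗ[k] ((Fin (n + 1) → G) → k) :=
  (inhomogeneousCochains.d (Rep.trivial k G k) n).hom

theorem dC_apply (n : ℕ) (f : (Fin n → G) → k) (x : Fin (n + 1) → G) :
    dC k G n f x = f (fun i => x i.succ) +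
      ∑ j : Fin (n + 1), (-1 : k) ^ ((j : ℕ) + 1) * f (Fin.contractNth j (· * ·) x) := rfl

/-- The Leibniz rule `d(f ∪ g) = df ∪ g + (-1)^p f ∪ dg`. -/
theorem dC_cupC {p q n : ℕ} (h : p + q = n) (f : (Fin p → G) → k) (g : (Fin q → G) → k) :
    dC k G n (cupC h f g) = cupC (by omega) (dC k G p f) g +
      (-1 : k) ^ p • cupC (by omega) f (dC k G q g) := by
  subst h
  ext x
  simp only [dC_apply, cupC_apply, Pi.add_apply, Pi.smul_apply, smul_eq_mul]
  have key := Fin.sum_univ_add (a := p) (b := q + 1) (fun j : Fin (p + (q + 1)) =>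
    (-1 : k) ^ ((j : ℕ) + 1) *
      (f (fun i => Fin.contractNth (n := p + q) j (· * ·) x ⟨i, by omega⟩) *
        g (fun i => Fin.contractNth (n := p + q) j (· * ·) x ⟨p + i, by omega⟩)))
  refine (congrArg _ key).trans ?_
  rw [Fin.sum_univ_castSucc (n := p)]
  have hA : ∀ i : Fin p,
      (f (fun m => Fin.contractNth (n := p + q) (Fin.castAdd (q + 1) i) (· * ·) x ⟨m, by omega⟩) *
        g (fun m => Fin.contractNth (n := p + q) (Fin.castAdd (q + 1) i) (· * ·) x ⟨p + m, by omega⟩)) =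
      f (Fin.contractNth i.castSucc (· * ·) (fun m : Fin (p + 1) => x ⟨m, by omega⟩)) *
        g (fun m => x ⟨p + 1 + m, by omega⟩) := by
    intro i
    congr 2
    ext m
    simp only [Fin.contractNth, Fin.val_castAdd]
    rw [if_neg (by omega), if_neg (by omega)]
    congr 1
    ext
    simp
    omega
  have hB : ∀ i : Fin (q + 1),
      (f (fun m => Fin.contractNth (n := p + q) (Fin.natAdd p i) (· * ·) x ⟨m, by omega⟩) *
        g (fun m => Fin.contractNth (n := p + q) (Fin.natAdd p i) (· * ·) x ⟨p + m, by omega⟩)) =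
      f (fun m => x ⟨m, by omega⟩) *
        g (Fin.contractNth i (· * ·) (fun m : Fin (q + 1) => x ⟨p + m, by omega⟩)) := by
    intro i
    congr 2
    · ext m
      simp only [Fin.contractNth, Fin.val_natAdd]
      rw [if_pos (by omega)]
      rfl
    · ext m
      simp only [Fin.contractNth, Fin.val_natAdd, add_lt_add_iff_left, add_right_inj]
      rfl
  have hC : f (Fin.contractNth (Fin.last p) (· * ·) (fun m : Fin (p + 1) => x ⟨m, by omega⟩)) =
      f (fun m => x ⟨m, by omega⟩) := by
    congr 1
    ext m
    simp only [Fin.contractNth, Fin.val_last]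
    rw [if_pos m.2]
    rfl
  have hR : ∀ c : k, (Rep.trivial k G k).ρ (x 0) c = c := fun _ => rfl
  have hD : (fun i : Fin p => x (Fin.succ ⟨(i : ℕ), by omega⟩)) =
      fun i : Fin p => x ⟨(i : ℕ) + 1, by omega⟩ := rfl
  have hE : (fun j : Fin q => x (Fin.succ ⟨p + (j : ℕ), by omega⟩)) =
      fun j : Fin q => x ⟨p + 1 + j, by omega⟩ := by
    ext j; congr 1; ext; simp; omega
  have hF : (fun j : Fin q => x ⟨p + ((j.succ : Fin (q + 1)) : ℕ), by simp⟩) =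
      fun j : Fin q => x ⟨p + 1 + j, by omega⟩ := by
    ext j; congr 1; ext; simp; omega
  simp only [hA, hB, hC, hE, hF, Fin.val_castAdd, Fin.val_natAdd, Fin.val_castSucc, Fin.val_last]
  simp only [add_mul, mul_add, Finset.sum_mul, Finset.mul_sum, pow_add, pow_one, mul_assoc]
  simp only [hR, hD, Fin.val_succ, mul_neg, neg_mul, one_mul, Finset.sum_neg_distrib]
  ring_nf


/-- The inhomogeneous cochain underlying a cocycle. -/
def toC (n : ℕ) : groupCohomology.cocycles (Rep.trivial k G k) n →ₗ[k] ((Fin n → G) → k) :=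
  (groupCohomology.iCocycles (Rep.trivial k G k) n).hom

/-- The class of a cocycle in cohomology. -/
def cls (n : ℕ) : groupCohomology.cocycles (Rep.trivial k G k) n →ₗ[k] H k G n :=
  (groupCohomology.π (Rep.trivial k G k) n).hom

theorem toC_injective (n : ℕ) : Function.Injective (toC (k := k) (G := G) n) :=
  (ModuleCat.mono_iff_injective (groupCohomology.iCocycles (Rep.trivial k G k) n)).1 inferInstance

theorem cls_surjective (n : ℕ) : Function.Surjective (cls (k := k) (G := G) n) :=
  (ModuleCat.epi_iff_surjective
    ((groupCohomology.inhomogeneousCochains (Rep.trivial k G k)).homologyπ n)).1 inferInstance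

theorem dC_toC (n : ℕ) (z : groupCohomology.cocycles (Rep.trivial k G k) n) :
    dC k G n (toC n z) = 0 := by
  have h := (groupCohomology.inhomogeneousCochains (Rep.trivial k G k)).iCycles_d n (n + 1)
  rw [groupCohomology.inhomogeneousCochains.d_def] at h
  exact congrArg (fun φ => φ.hom z) h

/-- The cocycle with a given underlying cochain that is killed by the differential. -/
def mkZ (n : ℕ) (f : (Fin n → G) → k) (h : dC k G n f = 0) :
    groupCohomology.cocycles (Rep.trivial k G k) n :=
  groupCohomology.cocyclesMk (A := Rep.trivial k G k) f h

theorem toC_mkZ (n : ℕ) (f : (Fin n → G) → k) (h : dC k G n f = 0) : toC n (mkZ n f h) = f :=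
  groupCohomology.iCocycles_mk (A := Rep.trivial k G k) f h

/-- A cocycle has class zero if and only if it is a coboundary. -/
theorem cls_eq_zero_iff (m n : ℕ) (h : (ComplexShape.up ℕ).prev n = m)
    (z : groupCohomology.cocycles (Rep.trivial k G k) n) :
    cls n z = 0 ↔ ∃ f, groupCohomology.toCocycles (Rep.trivial k G k) m n f = z := by
  have hex := ShortComplex.exact_of_g_is_cokernel
    (ShortComplex.mk _ _ (HomologicalComplex.toCycles_comp_homologyπ
      (groupCohomology.inhomogeneousCochains (Rep.trivial k G k)) m n))
    ((groupCohomology.inhomogeneousCochains (Rep.trivial k G k)).homologyIsCokernel m n h)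
  rw [ShortComplex.moduleCat_exact_iff] at hex
  refine ⟨fun hz => hex z hz, ?_⟩
  rintro ⟨f, rfl⟩
  exact congrArg (fun φ => φ.hom f) (HomologicalComplex.toCycles_comp_homologyπ
      (groupCohomology.inhomogeneousCochains (Rep.trivial k G k)) m n)

theorem cls_succ_eq_zero_iff (n : ℕ) (z : groupCohomology.cocycles (Rep.trivial k G k) (n + 1)) :
    cls (n + 1) z = 0 ↔ ∃ f : (Fin n → G) → k, dC k G n f = toC (n + 1) z := by
  have hi : ∀ f : (Fin n → G) → k,
      toC (n + 1) (groupCohomology.toCocycles (Rep.trivial k G k) n (n + 1) f) = dC k G n f := by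
    intro f
    have h := (groupCohomology.inhomogeneousCochains (Rep.trivial k G k)).toCycles_i n (n + 1)
    rw [groupCohomology.inhomogeneousCochains.d_def] at h
    exact congrArg (fun φ => φ.hom f) h
  rw [cls_eq_zero_iff n (n + 1) (by simp)]
  constructor
  · rintro ⟨f, rfl⟩
    exact ⟨f, (hi f).symm⟩
  · rintro ⟨f, hf⟩
    exact ⟨f, toC_injective _ ((hi f).trans hf)⟩

theorem cls_zero_eq_zero_iff (z : groupCohomology.cocycles (Rep.trivial k G k) 0) :
    cls 0 z = 0 ↔ z = 0 := by
  rw [cls_eq_zero_iff 0 0 (by simp)]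
  have h : groupCohomology.toCocycles (Rep.trivial k G k) 0 0 = 0 :=
    HomologicalComplex.toCycles_eq_zero _ (by simp)
  rw [h]
  exact ⟨fun ⟨_, hf⟩ => hf ▸ rfl, fun hz => ⟨0, hz ▸ rfl⟩⟩

theorem dC_cupC_toC {p q : ℕ} (a : groupCohomology.cocycles (Rep.trivial k G k) p)
    (b : groupCohomology.cocycles (Rep.trivial k G k) q) :
    dC k G (p + q) (cupC rfl (toC p a) (toC q b)) = 0 := by
  rw [dC_cupC, dC_toC, dC_toC]
  simp

/-- The cup product of cocycles. -/
def cupZ (p q : ℕ) : groupCohomology.cocycles (Rep.trivial k G k) p →ₗ[k]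
    groupCohomology.cocycles (Rep.trivial k G k) q →ₗ[k]
    groupCohomology.cocycles (Rep.trivial k G k) (p + q) :=
  LinearMap.mk₂ k (fun a b => mkZ (p + q) (cupC rfl (toC p a) (toC q b)) (dC_cupC_toC a b))
    (fun _ _ _ => toC_injective _ (by simp [toC_mkZ]))
    (fun _ _ _ => toC_injective _ (by simp [toC_mkZ]))
    (fun _ _ _ => toC_injective _ (by simp [toC_mkZ]))
    (fun _ _ _ => toC_injective _ (by simp [toC_mkZ]))

theorem toC_cupZ {p q : ℕ} (a : groupCohomology.cocycles (Rep.trivial k G k) p)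
    (b : groupCohomology.cocycles (Rep.trivial k G k) q) :
    toC (p + q) (cupZ p q a b) = cupC rfl (toC p a) (toC q b) :=
  toC_mkZ _ _ (dC_cupC_toC a b)

theorem cls_eq_zero_of_eq_d {n m : ℕ} (h : m + 1 = n)
    (z : groupCohomology.cocycles (Rep.trivial k G k) n) (f : (Fin m → G) → k)
    (hf : ∀ x : Fin n → G, toC n z x = dC k G m f (fun i => x (Fin.cast h i))) : cls n z = 0 := by
  subst h
  exact (cls_succ_eq_zero_iff m z).2 ⟨f, funext fun x => (hf x).symm⟩

theorem cls_cupZ_left {p q : ℕ} (a : groupCohomology.cocycles (Rep.trivial k G k) p)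
    (b : groupCohomology.cocycles (Rep.trivial k G k) q) (ha : cls p a = 0) :
    cls (p + q) (cupZ p q a b) = 0 := by
  cases p with
  | zero => rw [(cls_zero_eq_zero_iff a).1 ha]; simp
  | succ p =>
    obtain ⟨f, hf⟩ := (cls_succ_eq_zero_iff p a).1 ha
    refine cls_eq_zero_of_eq_d (m := p + q) (by omega) _ (cupC rfl f (toC q b)) fun x => ?_
    rw [toC_cupZ, ← hf, dC_cupC, dC_toC]
    simp [cupC_apply]

theorem cls_cupZ_right {p q : ℕ} (a : groupCohomology.cocycles (Rep.trivial k G k) p)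
    (b : groupCohomology.cocycles (Rep.trivial k G k) q) (hb : cls q b = 0) :
    cls (p + q) (cupZ p q a b) = 0 := by
  cases q with
  | zero => rw [(cls_zero_eq_zero_iff b).1 hb]; simp
  | succ q =>
    obtain ⟨g, hg⟩ := (cls_succ_eq_zero_iff q b).1 hb
    refine cls_eq_zero_of_eq_d (m := p + q) (by omega) _
      ((-1 : k) ^ p • cupC rfl (toC p a) g) fun x => ?_
    rw [toC_cupZ, ← hg, map_smul, dC_cupC, dC_toC, smul_add, smul_smul, ← mul_pow]
    simp [cupC_apply]

theorem cls_cupZ_congr {p q : ℕ} {a a' : groupCohomology.cocycles (Rep.trivial k G k) p}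
    {b b' : groupCohomology.cocycles (Rep.trivial k G k) q} (ha : cls p a = cls p a')
    (hb : cls q b = cls q b') :
    cls (p + q) (cupZ p q a b) = cls (p + q) (cupZ p q a' b') := by
  have h1 := cls_cupZ_left (a - a') b (by rw [map_sub, ha, sub_self])
  have h2 := cls_cupZ_right a' (b - b') (by rw [map_sub, hb, sub_self])
  rw [map_sub, LinearMap.sub_apply, map_sub, sub_eq_zero] at h1
  rw [map_sub, map_sub, sub_eq_zero] at h2
  exact h1.trans h2

/-- The cup product `H^p(G, k) × H^q(G, k) → H^{p+q}(G, k)`, induced by the cup product of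
cochains: the class of `f` times the class of `g` is the class of `f ∪ g`. -/
def cup (p q : ℕ) : H k G p →ₗ[k] H k G q →ₗ[k] H k G (p + q) :=
  LinearMap.mk₂ k
    (fun x y => cls (p + q) (cupZ p q (Function.surjInv (cls_surjective p) x)
      (Function.surjInv (cls_surjective q) y)))
    (fun x x' y => by
      rw [← map_add, ← LinearMap.add_apply, ← map_add]
      exact cls_cupZ_congr (by simp only [map_add, Function.surjInv_eq]) rfl)
    (fun c x y => by
      rw [← map_smul, ← LinearMap.smul_apply, ← map_smul]
      exact cls_cupZ_congr (by simp only [map_smul, Function.surjInv_eq]) rfl)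
    (fun x y y' => by
      rw [← map_add, ← map_add]
      exact cls_cupZ_congr rfl (by simp only [map_add, Function.surjInv_eq]))
    (fun c x y => by
      rw [← map_smul, ← map_smul]
      exact cls_cupZ_congr rfl (by simp only [map_smul, Function.surjInv_eq]))

theorem cup_cls {p q : ℕ} (a : groupCohomology.cocycles (Rep.trivial k G k) p)
    (b : groupCohomology.cocycles (Rep.trivial k G k) q) :
    cup p q (cls p a) (cls q b) = cls (p + q) (cupZ p q a b) :=
  cls_cupZ_congr (Function.surjInv_eq _ _) (Function.surjInv_eq _ _)

/-- The cup product on the total cohomology `H^*(G, k)`. -/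
def cupStar : HStar k G →ₗ[k] HStar k G →ₗ[k] HStar k G :=
  DirectSum.toModule k ℕ _ fun p => LinearMap.flip (DirectSum.toModule k ℕ _ fun q =>
    LinearMap.flip ((cup p q).compr₂ (DirectSum.lof k ℕ (fun n => H k G n) (p + q))))

theorem cupStar_of {p q : ℕ} (x : H k G p) (y : H k G q) :
    cupStar (DirectSum.of (fun n => H k G n) p x) (DirectSum.of (fun n => H k G n) q y) =
      DirectSum.of (fun n => H k G n) (p + q) (cup p q x y) := by
  simp only [← DirectSum.lof_eq_of k]
  simp [cupStar]

end Cup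

end CupProduct

namespace CyclotomicInertia

open NumberField

/-- The degree `deg e = ∑ᵢ eᵢ` of `e ∈ R = ℤ_{≥0}[S]`. -/
def deg {S : Type*} [Fintype S] (e : S → ℕ) : ℕ := ∑ i, e i

/-- `ω(e, e') = ∑_{j < i} e'_j e_i` for a total order on `S`. -/
def omegaPair {S : Type*} [Fintype S] [LinearOrder S] (e e' : S → ℕ) : ℕ := ∑ i, ∑ j with j < i, e' j * e i

/-- The subgroup `G_T = ∏_{i ∈ T} G_i` of `Gal(K/ℚ)`, where `G_i` is the inertia group of the prime
`P i` of `K`. -/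
def galT {S : Type*} {K : Type} [Field K] [NumberField K] (P : S → Ideal (𝓞 K)) (T : Set S) :
    Subgroup Gal(K/ℚ) :=
  ⨆ i ∈ T, (P i).inertia Gal(K/ℚ)

end CyclotomicInertia

end

/-!
The Galois group is a product of cyclic groups, and the classes `[e]` are the monomials in the standard
generators of the cohomology of the factors, multiplied in the order of the index set.

*Arithmetic.* The cyclotomic character identifies `Gal(K/ℚ)` with `∏ (ℤ/ℓ i)ˣ`. An element lies in
the inertia group at `ℓ i` exactly when its components at the other primes are trivial
(`CyclotomicInertia.mem_inertia_iff`): the roots of unity of order `ℓ j` stay distinct modulo a prime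
above `ℓ i` for `j ≠ i`, and conversely those of order `ℓ i` all become `1`, while the ring of integers
is generated by a root of unity. Choosing discrete logarithms, the group becomes a product of the groups
`ℤ/(ℓ i - 1)`, and the subgroup generated by the inertia groups with index in `T` is the product of the
factors with index in `T` (`CyclotomicInertia.mem_galT_iff`).

*Generators.* A character `χ : G → ℤ/N` gives, over a coefficient ring `k` in which `N = 0`, a class
`x` of degree one, the reduction of `χ`, and a class `y` of degree two, the pullback of the carry
cocycle. They satisfy `x² = (N / 2) y` for `N` even (`cls1_charX_sq`), classes of degree one
anticommute, and the classes of degree two are central; each of these relations is witnessed by an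
explicit cochain. This gives the product formula (`zprod_mul_zprod`). Since restriction to a
subgroup only restricts the characters, a monomial restricts to the corresponding monomial, and to zero if
it involves a character that becomes trivial.

*Basis.* It remains to see that the monomials form a basis of the cohomology of `G = A × ℤ/N` if they do
so for `A`. To avoid spectral sequences and tensor products of complexes, cochains of all degrees are
treated at once as functions on lists, and those with values in the module of functions on `ℤ/N`
as functions on `ℤ/N × List G`. By Shapiro's lemma, in the form of an explicit homotopy
(`dB_prism_add`), the latter have the cohomology of `A`. The exact sequence
`0 → k → Fun(ℤ/N) → Fun(ℤ/N) → k → 0`, whose maps are the constants, the translation difference `T` and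
the norm, then expresses a cocycle of `G`, up to a coboundary, as
`infl a + x ∪ infl b + y ∪ v`, with `a` and `b` cocycles of `A` and `v` a cocycle of `G` of lower degree
(`CyclicSplitting.exists_decomposition`). Hence the monomials generate (`exists_span`). The maps that
extract `a`, `b` and `v` are compatible with coboundaries, and composing them gives functionals
dual to the monomials that vanish on coboundaries (`exists_dual`), so the monomials are independent.
-/

noncomputable section

namespace ListCochain

/-! ### The differential of total inhomogeneous cochains -/

section Differential

variable {G H k : Type*} [CommRing k]

/-- The part of the differential of an inhomogeneous cochain that does not drop the first argument,
at `(g, g₁, …, gₙ)`: the alternating sum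
`F(g g₁, g₂, …) - F(g, g₁ g₂, …) + ⋯ ± F(g, g₁, …, gₙ₋₁)`. -/
def dAux [Mul G] : G → List G → ((List G → k) →ₗ[k] k)
  | _, [] => LinearMap.proj []
  | g, h :: l => LinearMap.proj (g * h :: l) - dAux h l ∘ₗ LinearMap.funLeft k k (List.cons g)

@[simp] theorem dAux_nil [Mul G] (g : G) (F : List G → k) : dAux g [] F = F [] := rfl

@[simp] theorem dAux_cons [Mul G] (g h : G) (l : List G) (F : List G → k) :
    dAux g (h :: l) F = F (g * h :: l) - dAux h l (fun r => F (g :: r)) := rfl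

theorem dAux_comp_map [Mul G] [Mul H] (φ : G → H) (hφ : ∀ a b, φ (a * b) = φ a * φ b)
    (F : List H → k) (g : G) (l : List G) :
    dAux g l (fun r => F (r.map φ)) = dAux (φ g) (l.map φ) F := by
  induction l generalizing g F with
  | nil => simp
  | cons h l ih => simp [hφ, ih (fun r => F (φ g :: r))]

/-- The identity behind `d ∘ d = 0`: in the iterated alternating sum, the terms cancel in pairs, except
those in which `g` and `h` are multiplied. -/
theorem dAux_dAux [Semigroup G] (g h : G) (l : List G) (F : List G → k) :
    dAux h l (fun r => dAux g r F) = dAux (g * h) l F := by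
  induction l generalizing g h F with
  | nil => rfl
  | cons j l ih =>
    have e : (fun r => dAux g (h :: r) F) =
        (fun r => F (g * h :: r)) - fun r => dAux h r fun r => F (g :: r) := rfl
    rw [dAux_cons, e, map_sub, ih, dAux_cons, dAux_cons, mul_assoc]
    ring

/-- The differential of total inhomogeneous cochains with constant coefficients. A total cochain is
a function on lists of all lengths, whose component of degree `n` is its restriction to the lists of
length `n`. The sign is that of the usual differential `F(g₁, …) - F(g₀ g₁, …) + ⋯`. -/
def dL [Mul G] : (List G → k) →ₗ[k] (List G → k) :=
  LinearMap.pi fun l => match l with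
    | [] => 0
    | g :: l => LinearMap.proj l - dAux g l

@[simp] theorem dL_nil [Mul G] (F : List G → k) : dL F [] = 0 := rfl

@[simp] theorem dL_cons [Mul G] (g : G) (l : List G) (F : List G → k) :
    dL F (g :: l) = F l - dAux g l F := rfl

/-- Pullback of cochains along a map of groups. -/
def pull (φ : G → H) : (List H → k) →ₗ[k] (List G → k) := LinearMap.funLeft k k (List.map φ)

@[simp] theorem pull_apply (φ : G → H) (F : List H → k) (l : List G) :
    pull φ F l = F (l.map φ) := rfl

theorem dL_pull [Mul G] [Mul H] (φ : G → H) (hφ : ∀ a b, φ (a * b) = φ a * φ b)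
    (F : List H → k) : dL (pull φ F) = pull φ (dL F) := by
  ext l
  cases l with
  | nil => simp
  | cons g l => simpa using! dAux_comp_map φ hφ F g l

end Differential

/-! ### The prism operator for cochains with values in functions -/

section Prism

variable {G C k : Type*} [CommRing k] [AddCommGroup C] (χ : G → C)

/-- Insertion of `g` as first argument, with the base point moved accordingly. -/
def shift (g : G) : (C × List G → k) →ₗ[k] (C × List G → k) :=
  LinearMap.funLeft k k fun x => (x.1 - χ g, g :: x.2)

@[simp] theorem shift_apply (g : G) (F : C × List G → k) (c : C) (l : List G) :
    shift χ g F (c, l) = F (c - χ g, g :: l) := rfl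

variable (τ : C → G) (p : G → G)

/-- The value of the prism operator at a chain of composable arrows of the action groupoid of `G`
on `C`, for the natural transformation `τ` to the projection `p`. -/
def prismAt : C → List G → ((C × List G → k) →ₗ[k] k)
  | c, [] => LinearMap.proj (c, [τ c])
  | c, g :: l => LinearMap.proj (c, τ c :: p g :: l.map p) - prismAt (c + χ g) l ∘ₗ shift χ g

/-- The prism operator. -/
def prism : (C × List G → k) →ₗ[k] (C × List G → k) :=
  LinearMap.pi fun x => prismAt χ τ p x.1 x.2

@[simp] theorem prism_nil (F : C × List G → k) (c : C) :
    prism χ τ p F (c, []) = F (c, [τ c]) := rfl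

@[simp] theorem prism_cons (F : C × List G → k) (c : C) (g : G) (l : List G) :
    prism χ τ p F (c, g :: l) =
      F (c, τ c :: p g :: l.map p) - prism χ τ p (shift χ g F) (c + χ g, l) := rfl

variable [Group G]

/-- The differential of total cochains with values in the functions on `C`, on which `G` acts by
translation through `χ`. -/
def dB : (C × List G → k) →ₗ[k] (C × List G → k) :=
  LinearMap.pi fun x => match x with
    | (_, []) => 0
    | (c, g :: l) =>
      LinearMap.proj (c + χ g, l) - dAux g l ∘ₗ LinearMap.funLeft k k (fun r => (c, r))

@[simp] theorem dB_nil (F : C × List G → k) (c : C) : dB χ F (c, []) = 0 := rfl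

@[simp] theorem dB_cons (F : C × List G → k) (c : C) (g : G) (l : List G) :
    dB χ F (c, g :: l) = F (c + χ g, l) - dAux g l (fun r => F (c, r)) := rfl

theorem dB_dB (hχ : ∀ a b, χ (a * b) = χ a + χ b) (F : C × List G → k) :
    dB χ (dB χ F) = 0 := by
  ext ⟨c, l⟩
  match l with
  | [] => simp
  | [g] => simp
  | g :: h :: l =>
    have e : (fun r => dB χ F (c, g :: r)) =
        (fun r => F (c + χ g, r)) - fun r => dAux g r fun r => F (c, r) := rfl
    rw [dB_cons, dB_cons, dAux_cons, dB_cons, e, map_sub, dAux_dAux, hχ, add_assoc]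
    simp

/-- The defect of commutation of `shift g` with the differential. -/
def shiftDefect (g : G) (F : C × List G → k) : C × List G → k
  | (c, []) => F (c - χ g, [])
  | (c, h :: r) => F (c - χ g, g * h :: r) - F (c + χ h - χ g, g :: r)

theorem shift_dB (g : G) (F : C × List G → k) :
    shift χ g (dB χ F) = F - dB χ (shift χ g F) - shiftDefect χ g F := by
  ext ⟨c, l⟩
  cases l with
  | nil => simp [shiftDefect]
  | cons h r => simp [shiftDefect]; ring

variable (hχ : ∀ a b, χ (a * b) = χ a + χ b)

include hχ in
theorem shift_shiftDefect (g h : G) (F : C × List G → k) :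
    shift χ h (shiftDefect χ g F) = shift χ (g * h) F - shift χ g F := by
  ext ⟨c, l⟩
  simp [shiftDefect, hχ, sub_sub, add_comm]

variable (hp : ∀ a b, p (a * b) = p a * p b) (hτ : ∀ c, χ (τ c) = -c)
  (hnat : ∀ c g, g * τ (c + χ g) = τ c * p g)

include hχ hp hτ hnat in
/-- The prism operator is a homotopy from the identity to the map induced by the projection `p`
followed by evaluation at the base point: cochains with values in functions on `C` have the
cohomology of the kernel of `χ`. -/
theorem dB_prism_add (F : C × List G → k) (c : C) (l : List G) :
    dB χ (prism χ τ p F) (c, l) + prism χ τ p (dB χ F) (c, l) =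
      F (0, l.map p) - F (c, l) := by
  induction l generalizing F c with
  | nil => simp [hτ]
  | cons g l ih =>
    have hn : g * τ (c + χ g) = τ c * p g := hnat c g
    have ih := ih (shift χ g F) (c + χ g)
    cases l with
    | nil =>
      simp only [dB_cons, prism_cons, prism_nil, shift_dB, Pi.sub_apply, shiftDefect,
        dAux_nil, List.map_nil, List.map_cons, dAux_cons, shift_apply, hn, hτ, dB_nil] at ih ⊢
      simp
      ring
    | cons h r =>
      have e1 : (fun r => prism χ τ p F (c, g :: r)) =
          (fun r => F (c, τ c :: p g :: r.map p)) -
          (fun r => prism χ τ p (shift χ g F) (c + χ g, r)) := by ext; simp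
      have e2 := dAux_comp_map p hp (fun r => F (c, τ c :: p g :: r)) h r
      simp only [List.map_cons] at ih ⊢
      rw [dB_cons] at ih ⊢
      rw [dAux_cons, e1, map_sub, e2, prism_cons (F := F), prism_cons (F := F),
        prism_cons (F := dB χ F), shift_dB, map_sub, map_sub, Pi.sub_apply, Pi.sub_apply,
        prism_cons (F := F), prism_cons (F := shiftDefect χ g F), shift_shiftDefect χ hχ]
      simp only [dB_cons, Pi.sub_apply, shiftDefect, List.map_cons, dAux_cons, shift_apply,
        hn, hτ, hχ, hp, map_sub, ← add_assoc, add_sub_cancel_right, add_neg_cancel, zero_sub] at ih ⊢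
      linear_combination ih

end Prism

/-! ### Multiplication by cocycles of degree one and two -/

section Generators

variable {G H k : Type*} [CommRing k]

/-- Left multiplication by a `1`-cochain. -/
def mul1 (a : G → k) : (List G → k) →ₗ[k] (List G → k) :=
  LinearMap.pi fun l => match l with
    | [] => 0
    | g :: l => a g • LinearMap.proj l

@[simp] theorem mul1_nil (a : G → k) (u : List G → k) : mul1 a u [] = 0 := rfl

@[simp] theorem mul1_cons (a : G → k) (u : List G → k) (g : G) (l : List G) :
    mul1 a u (g :: l) = a g * u l := rfl

/-- Left multiplication by a `2`-cochain. -/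
def mul2 (b : G → G → k) : (List G → k) →ₗ[k] (List G → k) :=
  LinearMap.pi fun l => match l with
    | [] => 0
    | [_] => 0
    | g :: h :: l => b g h • LinearMap.proj l

@[simp] theorem mul2_nil (b : G → G → k) (u : List G → k) : mul2 b u [] = 0 := rfl

@[simp] theorem mul2_singleton (b : G → G → k) (u : List G → k) (g : G) : mul2 b u [g] = 0 := rfl

@[simp] theorem mul2_cons (b : G → G → k) (u : List G → k) (g h : G) (l : List G) :
    mul2 b u (g :: h :: l) = b g h * u l := rfl

theorem dAux_const_mul [Mul G] (g : G) (l : List G) (r : k) (u : List G → k) :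
    dAux g l (fun x => r * u x) = r * dAux g l u :=
  (dAux g l).map_smul r u

theorem dL_mul1 [Mul G] (a : G → k) (ha : ∀ g h, a (g * h) = a g + a h) (u : List G → k) :
    dL (mul1 a u) = - mul1 a (dL u) := by
  ext l
  match l with
  | [] => simp
  | [g] => simp
  | g :: h :: l => simp [ha, dAux_const_mul]; ring

theorem dL_mul2 [Mul G] (b : G → G → k)
    (hb : ∀ g h j, b h j + b g (h * j) = b (g * h) j + b g h) (u : List G → k) :
    dL (mul2 b u) = mul2 b (dL u) := by
  ext l
  match l with
  | [] => simp
  | [g] => simp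
  | [g, h] => simp
  | g :: h :: j :: l =>
    simp [dAux_const_mul]
    linear_combination u l * hb g h j

theorem pull_mul1 (φ : G → H) (a : H → k) (u : List H → k) :
    pull φ (mul1 a u) = mul1 (a ∘ φ) (pull φ u) := by
  ext l; cases l <;> simp

theorem pull_mul2 (φ : G → H) (b : H → H → k) (u : List H → k) :
    pull φ (mul2 b u) = mul2 (fun g h => b (φ g) (φ h)) (pull φ u) := by
  ext l
  match l with
  | [] => simp
  | [g] => simp
  | g :: h :: l => simp

end Generators

/-! ### The carry cocycle and the generators of a cyclic factor -/

section Carry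

variable {N : ℕ} [NeZero N]

/-- The carry of the addition of two residues modulo `N`. -/
def carry (a b : ZMod N) : ℕ := (a.val + b.val) / N

theorem mul_carry_add (a b : ZMod N) : N * carry a b + (a + b).val = a.val + b.val := by
  rw [ZMod.val_add, carry, Nat.div_add_mod]

omit [NeZero N] in
theorem carry_comm (a b : ZMod N) : carry a b = carry b a := by
  rw [carry, carry, add_comm]

@[simp] theorem carry_zero (a : ZMod N) : carry a 0 = 0 := by
  simp [carry, ZMod.val_lt a]

@[simp] theorem zero_carry (a : ZMod N) : carry 0 a = 0 := by
  rw [carry_comm, carry_zero]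

theorem carry_cocycle (a b c : ZMod N) :
    carry b c + carry a (b + c) = carry (a + b) c + carry a b := by
  have h1 := mul_carry_add b c
  have h2 := mul_carry_add a (b + c)
  have h3 := mul_carry_add (a + b) c
  have h4 := mul_carry_add a b
  rw [add_assoc] at h3
  refine Nat.eq_of_mul_eq_mul_left (NeZero.pos N) ?_
  rw [mul_add, mul_add]
  omega

/-- Only the residue `N - 1` produces a carry when `1` is added. -/
theorem sum_carry_one (hN : 1 < N) : ∑ c : ZMod N, carry c 1 = 1 := by
  have h : ∑ c : ZMod N, (N * carry c 1 + (c + 1).val) = ∑ c : ZMod N, (c.val + 1) := by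
    refine Finset.sum_congr rfl fun c _ => ?_
    have : Fact (1 < N) := ⟨hN⟩
    rw [mul_carry_add, ZMod.val_one]
  have h2 : ∑ c : ZMod N, (c + 1).val = ∑ c : ZMod N, c.val :=
    Equiv.sum_comp (Equiv.addRight (1 : ZMod N)) fun c => c.val
  rw [Finset.sum_add_distrib, Finset.sum_add_distrib, h2, ← Finset.mul_sum] at h
  have h3 : N * ∑ c : ZMod N, carry c 1 = N * 1 := by
    simp only [Finset.sum_const, Finset.card_univ, ZMod.card, smul_eq_mul] at h
    linarith
  exact Nat.eq_of_mul_eq_mul_left (NeZero.pos N) h3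

variable {G : Type*} [Group G] {k : Type*} [CommRing k] (χ : G →* Multiplicative (ZMod N))

/-- The `1`-cochain with values in `k` given by a character with values in `ℤ/N`. It is a
homomorphism if `N = 0` in `k`. -/
def charX (k : Type*) [CommRing k] (g : G) : k := ((χ g).toAdd.val : k)

/-- The `2`-cocycle with values in `k` that is the pullback of the extension of `ℤ/N` by `ℤ`
along a character with values in `ℤ/N`. -/
def charY (k : Type*) [CommRing k] (g h : G) : k := (carry (χ g).toAdd (χ h).toAdd : k)

theorem val_add_cast (hN : (N : k) = 0) (a b : ZMod N) :
    (((a + b).val : ℕ) : k) = a.val + b.val := by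
  have := congrArg (Nat.cast (R := k)) (mul_carry_add a b)
  push_cast at this
  simpa [hN] using this

theorem charX_mul (hN : (N : k) = 0) (g h : G) : charX χ k (g * h) = charX χ k g + charX χ k h := by
  simp [charX, val_add_cast hN]

theorem charY_cocycle (g h j : G) :
    charY χ k h j + charY χ k g (h * j) = charY χ k (g * h) j + charY χ k g h := by
  simp only [charY, map_mul, toAdd_mul]
  exact_mod_cast congrArg (Nat.cast (R := k)) (carry_cocycle _ _ _)

theorem dL_mul1_charX (hN : (N : k) = 0) (u : List G → k) :
    dL (mul1 (charX χ k) u) = - mul1 (charX χ k) (dL u) := dL_mul1 _ (charX_mul χ hN) u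

theorem dL_mul2_charY (u : List G → k) :
    dL (mul2 (charY χ k) u) = mul2 (charY χ k) (dL u) := dL_mul2 _ (charY_cocycle χ) u

end Carry

/-! ### Functions on the cyclic factor, and split cyclic quotients -/

namespace CyclicSplitting

section Functions

variable {G : Type*} {N : ℕ} {k : Type*} [CommRing k]

/-- Constant functions on `ℤ/N`. -/
def const : (List G → k) →ₗ[k] (ZMod N × List G → k) := LinearMap.funLeft k k Prod.snd

/-- Evaluation at the base point. -/
def ev : (ZMod N × List G → k) →ₗ[k] (List G → k) := LinearMap.funLeft k k fun l => (0, l)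

/-- Translation by the generator of `ℤ/N`, minus the identity. -/
def T : (ZMod N × List G → k) →ₗ[k] (ZMod N × List G → k) :=
  LinearMap.funLeft k k (fun x => (x.1 + 1, x.2)) - LinearMap.id

/-- The sum of the translates by the elements of `ℤ/N`. -/
def norm [NeZero N] : (ZMod N × List G → k) →ₗ[k] (List G → k) :=
  ∑ c : ZMod N, LinearMap.funLeft k k fun l => (c, l)

@[simp] theorem const_apply (f : List G → k) (c : ZMod N) (l : List G) :
    const f (c, l) = f l := rfl

@[simp] theorem ev_apply (F : ZMod N × List G → k) (l : List G) : ev F l = F (0, l) := rfl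

@[simp] theorem T_apply (F : ZMod N × List G → k) (c : ZMod N) (l : List G) :
    T F (c, l) = F (c + 1, l) - F (c, l) := rfl

@[simp] theorem norm_apply [NeZero N] (F : ZMod N × List G → k) (l : List G) :
    norm F l = ∑ c : ZMod N, F (c, l) := by
  simp [norm, LinearMap.funLeft_apply]

@[simp] theorem T_const (f : List G → k) : T (const (N := N) f) = 0 := by
  ext ⟨c, l⟩; simp

theorem norm_T [NeZero N] (F : ZMod N × List G → k) : norm (T F) = 0 := by
  ext l
  simpa [sub_eq_zero] using Equiv.sum_comp (Equiv.addRight (1 : ZMod N)) fun c => F (c, l)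

theorem norm_const [NeZero N] (hN : (N : k) = 0) (f : List G → k) :
    norm (const (N := N) f) = 0 := by
  ext l; simp [hN]

/-- The functions on `ℤ/N` invariant under translation are the constants. -/
theorem eq_const_of_T_eq_zero [NeZero N] {F : ZMod N × List G → k} (h : T F = 0) :
    F = const (ev F) := by
  ext ⟨c, l⟩
  have : ∀ n : ℕ, F ((n : ZMod N), l) = F (0, l) := by
    intro n
    induction n with
    | zero => simp
    | succ n ih =>
      have := congrFun h (n, l)
      rw [T_apply, Pi.zero_apply, sub_eq_zero] at this
      rw [Nat.cast_succ, this, ih]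
  simpa using this c.val

/-- A function on `ℤ/N` with sum zero is a difference of translates: its partial sums are
periodic. -/
theorem exists_T_eq_of_norm_eq_zero [NeZero N] {F : ZMod N × List G → k} (h : norm F = 0) :
    ∃ w, T w = F := by
  refine ⟨fun x => ∑ j ∈ Finset.range x.1.val, F ((j : ZMod N), x.2), ?_⟩
  ext ⟨c, l⟩
  have hc := ZMod.val_lt c
  have hv : (c + 1).val = (c.val + 1) % N := by
    rw [ZMod.val_add, ZMod.val_one_eq_one_mod, Nat.add_mod_mod]
  rw [T_apply, sub_eq_iff_eq_add']
  have hs : (∑ j ∈ Finset.range c.val, F ((j : ZMod N), l)) + F (c, l) =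
      ∑ j ∈ Finset.range (c.val + 1), F ((j : ZMod N), l) := by
    rw [Finset.sum_range_succ, ZMod.natCast_zmod_val]
  rw [hs, hv]
  rcases (show c.val + 1 ≤ N from hc).lt_or_eq with hlt | heq
  · rw [Nat.mod_eq_of_lt hlt]
  · rw [heq, Nat.mod_self, Finset.sum_range_zero, ← Pi.zero_apply (M := fun _ => k) l, ← h,
      norm_apply]
    exact Finset.sum_nbij' ZMod.val (fun j => (j : ZMod N)) (by simp [ZMod.val_lt]) (by simp)
      (by simp) (fun j hj => ZMod.val_cast_of_lt (by simpa using hj)) (by simp)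

end Functions

end CyclicSplitting

/-- A commutative group `G` together with a split surjection to the cyclic group `ℤ/N`. -/
structure CyclicSplitting (G : Type*) [Group G] (N : ℕ) where
  /-- the surjection -/
  χ : G →* Multiplicative (ZMod N)
  /-- the section -/
  σ : Multiplicative (ZMod N) →* G
  χ_σ : ∀ c, χ (σ c) = c
  comm : ∀ a b : G, a * b = b * a

namespace CyclicSplitting

variable {G : Type*} [Group G] {N : ℕ} (D : CyclicSplitting G N) {k : Type*} [CommRing k]

/-- The projection of `G` to the kernel of `χ`. -/
def proj : G →* D.χ.ker where
  toFun g := ⟨g * (D.σ (D.χ g))⁻¹, by simp [MonoidHom.mem_ker, D.χ_σ]⟩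
  map_one' := by simp
  map_mul' a b := by
    ext
    simp only [map_mul, Subgroup.coe_mul]
    rw [mul_inv_rev, D.comm (D.σ (D.χ b))⁻¹, mul_assoc, ← mul_assoc b, D.comm b]
    simp only [mul_assoc]

theorem coe_proj (g : G) : (D.proj g : G) = g * (D.σ (D.χ g))⁻¹ := rfl

@[simp] theorem proj_coe (a : D.χ.ker) : D.proj a = a := by
  ext
  simp [coe_proj, (MonoidHom.mem_ker).1 a.2]

@[simp] theorem proj_σ (c : Multiplicative (ZMod N)) : D.proj (D.σ c) = 1 := by
  ext
  simp [coe_proj, D.χ_σ]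

/-- The character of a splitting, written additively. -/
def ch (g : G) : ZMod N := (D.χ g).toAdd

theorem ch_mul (a b : G) : D.ch (a * b) = D.ch a + D.ch b := by simp [ch]

@[simp] theorem ch_coe (a : D.χ.ker) : D.ch a = 0 := by simp [ch, (MonoidHom.mem_ker).1 a.2]

/-- The element of the image of the section that moves `c` to the base point `0`: an arrow of the
action groupoid of `G` on `ℤ/N`. -/
def τ (c : ZMod N) : G := D.σ (Multiplicative.ofAdd (-c))

/-- Inflation of cochains of the kernel of `χ` along the projection. -/
def infl : (List D.χ.ker → k) →ₗ[k] (List G → k) := pull D.proj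

/-- Restriction of cochains to the kernel of `χ`. -/
def restr : (List G → k) →ₗ[k] (List D.χ.ker → k) := pull Subtype.val

@[simp] theorem infl_apply (a : List D.χ.ker → k) (l : List G) :
    D.infl a l = a (l.map D.proj) := rfl

@[simp] theorem restr_apply (f : List G → k) (l : List D.χ.ker) :
    D.restr f l = f (l.map Subtype.val) := rfl

@[simp] theorem restr_infl (a : List D.χ.ker → k) : D.restr (D.infl a) = a := by
  ext l
  rw [restr_apply, infl_apply, List.map_map, Function.comp_def]
  simp

theorem dL_infl (a : List D.χ.ker → k) : dL (D.infl a) = D.infl (dL a) :=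
  dL_pull _ (map_mul D.proj) a

theorem dL_restr (f : List G → k) : dL (D.restr f) = D.restr (dL f) :=
  dL_pull _ (fun _ _ => rfl) f

/-- The homotopy between the identity of the cochains with values in the functions on `ℤ/N` and
the map induced by `proj`; see `dB_s`. -/
def s : (ZMod N × List G → k) →ₗ[k] (ZMod N × List G → k) :=
  - prism D.ch D.τ (fun g => (D.proj g : G))

variable {D}

theorem dB_const (f : List G → k) : dB D.ch (const f) = const (dL f) := by
  ext ⟨c, l⟩; cases l <;> simp

theorem dB_T (F : ZMod N × List G → k) : dB D.ch (T F) = T (dB D.ch F) := by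
  ext ⟨c, l⟩
  cases l with
  | nil => simp
  | cons g l =>
    have : (fun r => T F (c, r)) = (fun r => F (c + 1, r)) - fun r => F (c, r) := rfl
    rw [dB_cons, this, map_sub, T_apply, T_apply, dB_cons, dB_cons, add_right_comm]
    ring

theorem dL_norm [NeZero N] (F : ZMod N × List G → k) : dL (norm F) = norm (dB D.ch F) := by
  ext l
  cases l with
  | nil => simp
  | cons g l =>
    have : norm F = ∑ c : ZMod N, fun r => F (c, r) := by ext; simp
    simp only [dL_cons, norm_apply, dB_cons, Finset.sum_sub_distrib]
    rw [this, map_sum, ← Equiv.sum_comp (Equiv.addRight (D.ch g)) fun c => F (c, l)]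
    rfl

theorem dL_restr_ev (F : ZMod N × List G → k) :
    dL (D.restr (ev F)) = D.restr (ev (dB D.ch F)) := by
  rw [dL_restr]
  ext l
  cases l with
  | nil => simp
  | cons g l => simp; rfl

variable (D) in
theorem dB_s (F : ZMod N × List G → k) :
    dB D.ch (D.s F) = F - const (D.infl (D.restr (ev F))) - D.s (dB D.ch F) := by
  ext ⟨c, l⟩
  have := dB_prism_add D.ch D.τ (fun g => (D.proj g : G)) D.ch_mul (by simp)
    (by simp [ch, τ, D.χ_σ]) (fun c g => by
      rw [coe_proj, ← mul_assoc, D.comm (D.τ c), mul_assoc]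
      simp [τ, ch, ofAdd_add, D.comm]) F c l
  simp only [s, LinearMap.neg_apply, map_neg, Pi.neg_apply, Pi.sub_apply, const_apply, infl_apply,
    restr_apply, ev_apply, List.map_map, Function.comp_def]
  linear_combination -this

variable (D) in
/-- The homotopy sends a constant function inflated from the kernel to a constant function, because
the projection of `τ c` to the kernel is trivial. -/
theorem T_s_const_infl (a : List D.χ.ker → k) : T (D.s (const (D.infl a))) = 0 := by
  have key : ∀ (l : List G) (f : List D.χ.ker → k) (c c' : ZMod N),
      prism D.ch D.τ (fun g => (D.proj g : G)) (const (D.infl f)) (c, l) =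
        prism D.ch D.τ (fun g => (D.proj g : G)) (const (D.infl f)) (c', l) := by
    intro l
    induction l with
    | nil => intro f c c'; simp [τ]
    | cons g l ih =>
      intro f c c'
      have : shift D.ch g (const (D.infl f)) = const (D.infl fun r => f (D.proj g :: r)) := by
        ext ⟨c, l⟩; simp
      simp only [prism_cons, this, ih _ (c + D.ch g) (c' + D.ch g)]
      simp [τ]
  ext ⟨c, l⟩
  simp [s, key l a (c + 1) c]

theorem norm_s_const_infl [NeZero N] (hN : (N : k) = 0) (a : List D.χ.ker → k) :
    norm (D.s (const (D.infl a))) = 0 := by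
  rw [eq_const_of_T_eq_zero (T_s_const_infl D a), norm_const hN]

end CyclicSplitting

/-! ### The decomposition of a cocycle along a cyclic factor -/

namespace CyclicSplitting

section Multiplication

variable {G : Type*} {N : ℕ} {k : Type*} [CommRing k]

/-- Left multiplication by a `0`-cochain with values in the functions on `ℤ/N`. -/
def bmul0 (φ : ZMod N → k) (u : List G → k) : ZMod N × List G → k := fun x => φ x.1 * u x.2

/-- Left multiplication by a `1`-cochain with values in the functions on `ℤ/N`. -/
def bmul1 (θ : ZMod N → G → k) (u : List G → k) : ZMod N × List G → k
  | (_, []) => 0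
  | (c, g :: l) => θ c g * u l

theorem norm_bmul0 [NeZero N] (φ : ZMod N → k) (hφ : ∑ c, φ c = 1) (u : List G → k) :
    norm (bmul0 φ u) = u := by
  ext l; simp [bmul0, ← Finset.sum_mul, hφ]

end Multiplication

variable {G : Type*} [Group G] {N : ℕ} [NeZero N] (D : CyclicSplitting G N) {k : Type*} [CommRing k]

omit [NeZero N] in
theorem dB_bmul0 (φ : ZMod N → k) (u : List G → k) :
    dB D.ch (bmul0 φ u) =
      bmul1 (fun c g => φ (c + D.ch g) - φ c) u + bmul0 φ (dL u) := by
  ext ⟨c, l⟩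
  cases l with
  | nil => simp [bmul0, bmul1]
  | cons g l => simp [bmul0, bmul1, dAux_const_mul]; ring

/-- The identity function of `ℤ/N` bounds the character `charX` in the cochains with values in the
functions on `ℤ/N`. -/
theorem dB_bmul0_val (hN : (N : k) = 0) (u : List G → k) :
    dB D.ch (bmul0 (fun c => (c.val : k)) u) =
      const (mul1 (charX D.χ k) u) + bmul0 (fun c => (c.val : k)) (dL u) := by
  rw [dB_bmul0]
  congr 1
  ext ⟨c, l⟩
  cases l with
  | nil => rfl
  | cons g l => simp [bmul1, val_add_cast hN, charX, ch]

omit [Group G] in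
theorem T_bmul0_val (hN : (N : k) = 0) (hN1 : 1 < N) (u : List G → k) :
    T (bmul0 (fun c : ZMod N => (c.val : k)) u) = const u := by
  have : Fact (1 < N) := ⟨hN1⟩
  ext ⟨c, l⟩
  simp only [T_apply, bmul0, val_add_cast hN, ZMod.val_one, const_apply, Nat.cast_one]
  ring

/-- The carry bounds `charY` in the cochains with values in the functions on `ℤ/N`. -/
theorem dB_bmul1_carry (u : List G → k) :
    dB D.ch (bmul1 (fun c g => (carry c (D.ch g) : k)) u) =
      const (mul2 (charY D.χ k) u) - bmul1 (fun c g => (carry c (D.ch g) : k)) (dL u) := by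
  ext ⟨c, l⟩
  match l with
  | [] => simp [bmul1]
  | [g] => simp [bmul1]
  | g :: h :: l =>
    have := congrArg (Nat.cast (R := k)) (carry_cocycle c (D.ch g) (D.ch h))
    push_cast at this
    simp only [bmul1, dB_cons, dAux_cons, dAux_const_mul, D.ch_mul, const_apply, Pi.sub_apply,
      mul2_cons, dL_cons, charY]
    simp only [ch] at *
    linear_combination - u l * this

/-- Translation changes the cochain bounding `charY ∪ u` by a coboundary. The function on `ℤ/N`
that appears has sum `1`, by `sum_carry_one`. -/
theorem T_bmul1_carry (u : List G → k) (hu : dL u = 0) :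
    T (bmul1 (fun c g => (carry c (D.ch g) : k)) u) =
      dB D.ch (bmul0 (fun c => (carry c 1 : k)) u) := by
  rw [dB_bmul0, hu]
  ext ⟨c, l⟩
  cases l with
  | nil => simp [bmul1, bmul0]
  | cons g l =>
    have h := congrArg (Nat.cast (R := k)) (carry_cocycle (D.ch g) c 1)
    rw [carry_comm (D.ch g), carry_comm (D.ch g), add_comm (D.ch g)] at h
    push_cast at h
    simp only [T_apply, bmul1, Pi.add_apply, bmul0, Pi.zero_apply]
    linear_combination u l * h

omit [NeZero N] in
theorem T_s_dB (W : ZMod N × List G → k) :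
    T (D.s (dB D.ch W)) = T W - dB D.ch (T (D.s W)) := by
  rw [dB_T, dB_s, map_sub, map_sub, T_const]
  abel

theorem norm_s_dB (hN : (N : k) = 0) (W : ZMod N × List G → k) :
    norm (D.s (dB D.ch W)) = norm W - dL (norm (D.s W)) := by
  rw [dL_norm (D := D), dB_s, map_sub, map_sub, norm_const hN]
  abel

/-- The first derived component of a cochain, in the cochains of the kernel of `χ`. On cohomology,
it is the coefficient of `charX`: up to coboundaries, it kills the cocycles inflated from the kernel
and the multiples of `charY`, and it maps `charX ∪ infl a` to `a`. -/
def pr1 : (List G → k) →ₗ[k] (List D.χ.ker → k) := D.restr ∘ₗ ev ∘ₗ T ∘ₗ D.s ∘ₗ const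

/-- The second derived component of a cochain. On cohomology, it is the coefficient of `charY`: up
to coboundaries, it kills `infl a` and `charX ∪ infl a`, and it maps `charY ∪ v` to `v`. -/
def pr2 : (List G → k) →ₗ[k] (List G → k) := norm ∘ₗ D.s ∘ₗ T ∘ₗ D.s ∘ₗ const

omit [NeZero N] in
theorem pr1_apply (f : List G → k) : D.pr1 f = D.restr (ev (T (D.s (const f)))) := rfl

theorem pr2_apply (f : List G → k) : D.pr2 f = norm (D.s (T (D.s (const f)))) := rfl

omit [NeZero N] in
theorem pr1_dL (m : List G → k) : ∃ m', D.pr1 (dL m) = dL m' := by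
  refine ⟨- D.restr (ev (T (D.s (const m)))), ?_⟩
  rw [pr1_apply, ← dB_const (D := D), T_s_dB, T_const, zero_sub, map_neg, map_neg, map_neg,
    dL_restr_ev]

theorem pr2_dL (hN : (N : k) = 0) (m : List G → k) : ∃ m', D.pr2 (dL m) = dL m' := by
  refine ⟨norm (D.s (T (D.s (const m)))), ?_⟩
  rw [pr2_apply, ← dB_const (D := D), T_s_dB, T_const, zero_sub, map_neg, map_neg, norm_s_dB _ hN,
    norm_T, zero_sub, neg_neg]

omit [NeZero N] in
theorem pr1_infl (a : List D.χ.ker → k) : D.pr1 (D.infl a) = 0 := by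
  rw [pr1_apply, T_s_const_infl, map_zero, map_zero]

theorem pr2_infl (a : List D.χ.ker → k) : D.pr2 (D.infl a) = 0 := by
  rw [pr2_apply, T_s_const_infl, map_zero, map_zero]

omit [NeZero N] in
theorem restr_mul1 (u : List G → k) : D.restr (mul1 (charX D.χ k) u) = 0 := by
  ext l
  cases l with
  | nil => simp
  | cons g l => simp [charX, (MonoidHom.mem_ker).1 g.2]

theorem restr_mul2 (u : List G → k) : D.restr (mul2 (charY D.χ k) u) = 0 := by
  ext l
  match l with
  | [] => simp
  | [g] => simp
  | g :: h :: l => simp [charY, (MonoidHom.mem_ker).1 g.2]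

omit [NeZero N] in
theorem dL_infl_eq_zero {a : List D.χ.ker → k} (ha : dL a = 0) : dL (D.infl a) = 0 := by
  rw [dL_infl, ha, map_zero]

theorem const_mul1_infl (hN : (N : k) = 0) {a : List D.χ.ker → k} (ha : dL a = 0) :
    const (mul1 (charX D.χ k) (D.infl a)) =
      dB D.ch (bmul0 (fun c => (c.val : k)) (D.infl a)) := by
  rw [dB_bmul0_val _ hN, D.dL_infl_eq_zero ha]
  ext; simp [bmul0]

theorem const_mul2 {v : List G → k} (hv : dL v = 0) :
    const (mul2 (charY D.χ k) v) =
      dB D.ch (bmul1 (fun c g => (carry c (D.ch g) : k)) v) := by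
  rw [dB_bmul1_carry, hv]
  ext ⟨c, l⟩; cases l <;> simp [bmul1]

theorem pr1_mul1_infl (hN : (N : k) = 0) (hN1 : 1 < N) {a : List D.χ.ker → k} (ha : dL a = 0) :
    ∃ m, D.pr1 (mul1 (charX D.χ k) (D.infl a)) = a + dL m := by
  refine ⟨- D.restr (ev (T (D.s (bmul0 (fun c => (c.val : k)) (D.infl a))))), ?_⟩
  rw [pr1_apply, D.const_mul1_infl hN ha, T_s_dB, T_bmul0_val hN hN1, map_sub, map_sub,
    map_neg, dL_restr_ev, sub_eq_add_neg]
  congr 1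
  exact D.restr_infl a

theorem pr2_mul1_infl (hN : (N : k) = 0) (hN1 : 1 < N) {a : List D.χ.ker → k} (ha : dL a = 0) :
    ∃ m, D.pr2 (mul1 (charX D.χ k) (D.infl a)) = dL m := by
  refine ⟨norm (D.s (T (D.s (bmul0 (fun c => (c.val : k)) (D.infl a))))), ?_⟩
  rw [pr2_apply, D.const_mul1_infl hN ha, T_s_dB, T_bmul0_val hN hN1, map_sub, map_sub,
    norm_s_const_infl hN, norm_s_dB _ hN, norm_T, zero_sub, zero_sub, neg_neg]

theorem pr1_mul2 {v : List G → k} (hv : dL v = 0) :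
    ∃ m, D.pr1 (mul2 (charY D.χ k) v) = dL m := by
  refine ⟨D.restr (ev (bmul0 (fun c => (carry c 1 : k)) v -
    T (D.s (bmul1 (fun c g => (carry c (D.ch g) : k)) v)))), ?_⟩
  rw [pr1_apply, D.const_mul2 hv, T_s_dB, T_bmul1_carry _ _ hv, dL_restr_ev, ← map_sub]

theorem pr2_mul2 (hN : (N : k) = 0) (hN1 : 1 < N) {v : List G → k} (hv : dL v = 0) :
    ∃ m, D.pr2 (mul2 (charY D.χ k) v) = v + dL m := by
  refine ⟨- norm (D.s (bmul0 (fun c => (carry c 1 : k)) v -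
    T (D.s (bmul1 (fun c g => (carry c (D.ch g) : k)) v)))), ?_⟩
  have hs : ∑ c : ZMod N, (carry c 1 : k) = 1 := by
    rw [← Nat.cast_sum, sum_carry_one hN1, Nat.cast_one]
  rw [pr2_apply, D.const_mul2 hv, T_s_dB, T_bmul1_carry _ _ hv, ← map_sub, norm_s_dB _ hN,
    map_sub norm, norm_T, norm_bmul0 _ hs, sub_zero, map_neg, sub_eq_add_neg]

/-- A cocycle is cohomologous to the sum of its three components. The constant function on `ℤ/N` with
value `f - infl (restr f)` is the coboundary of `h = s (const f)`. If `h` were constant, `f` would be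
cohomologous to `infl (restr f)`. The obstruction is the cocycle `T h`, which is cohomologous to
the constant function with value a cocycle `a` of the kernel, and then a function on `ℤ/N` with sum
`u`; they are removed by subtracting from `h` the cochains bounding `charX ∪ a` and `charY ∪ u`. -/
theorem exists_decomposition (hN : (N : k) = 0) (hN1 : 1 < N) {f : List G → k} (hf : dL f = 0) :
    dL (D.pr1 f) = 0 ∧ dL (D.pr2 f) = 0 ∧
    ∃ m, f = D.infl (D.restr f) + mul1 (charX D.χ k) (D.infl (D.pr1 f)) +
      mul2 (charY D.χ k) (D.pr2 f) + dL m := by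
  set h := D.s (const f) with hh
  have h1 : dB D.ch h = const (f - D.infl (D.restr f)) := by
    rw [hh, dB_s, dB_const, hf, map_zero, map_zero, sub_zero, map_sub]
    rfl
  have hT : dB D.ch (T h) = 0 := by rw [dB_T, h1, T_const]
  set a := D.pr1 f with ha
  have ha0 : dL a = 0 := by
    rw [ha, pr1_apply, dL_restr_ev, ← hh, hT, map_zero, map_zero]
  set h2 := D.s (T h) with hh2
  have h3 : dB D.ch h2 = T h - const (D.infl a) := by
    rw [hh2, dB_s, hT, map_zero, sub_zero]
    rfl
  have hu : D.pr2 f = norm h2 := rfl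
  set u := D.pr2 f with hu'
  have hu0 : dL u = 0 := by
    rw [hu, dL_norm (D := D), h3, map_sub, norm_T, norm_const hN, sub_zero]
  refine ⟨ha0, hu0, ?_⟩
  have hs : ∑ c : ZMod N, (carry c 1 : k) = 1 := by
    rw [← Nat.cast_sum, sum_carry_one hN1, Nat.cast_one]
  -- Both `h2` and `bmul0 (carry · 1) u` have norm `u`, so they differ by a translation difference.
  obtain ⟨w, hw⟩ := exists_T_eq_of_norm_eq_zero
    (F := h2 - bmul0 (fun c => (carry c 1 : k)) u)
    (by rw [map_sub, norm_bmul0 _ hs, hu, sub_self])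
  set e := h - bmul0 (fun c => (c.val : k)) (D.infl a) - dB D.ch w -
    bmul1 (fun c g => (carry c (D.ch g) : k)) u with he
  -- The correction `e` of `h` is a constant function, and its value bounds the required difference.
  have hTe : T e = 0 := by
    rw [he, map_sub, map_sub, map_sub, T_bmul0_val hN hN1, T_bmul1_carry _ _ hu0, ← dB_T, hw,
      map_sub, h3]
    abel
  have hc := dB_const (D := D) (ev e)
  rw [← eq_const_of_T_eq_zero hTe] at hc
  have hde : dB D.ch e = const (f - D.infl (D.restr f) - mul1 (charX D.χ k) (D.infl a) -
      mul2 (charY D.χ k) u) := by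
    rw [he, map_sub, map_sub, map_sub, h1, dB_dB D.ch D.ch_mul, ← D.const_mul1_infl hN ha0,
      ← D.const_mul2 hu0, sub_zero]
    simp only [map_sub]
  refine ⟨ev e, funext fun l => ?_⟩
  have := congrFun (hc.symm.trans hde) (0, l)
  simp only [const_apply, Pi.sub_apply] at this
  simp only [Pi.add_apply, this]
  ring

end CyclicSplitting

/-! ### Monomial cocycles -/

section Monomials

variable {G H k : Type*} [CommRing k] [Group G] [Group H]

/-- The unit of the algebra of total cochains. -/
def unitC : List G → k
  | [] => 1
  | _ :: _ => 0

/-- Left multiplication by the generator of degree `n` of the cohomology of `ℤ/N`, which is `yᵐ` for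
`n = 2 m` and `yᵐ x` for `n = 2 m + 1`. -/
def power {N : ℕ} (χ : G →* Multiplicative (ZMod N)) : ℕ → (List G → k) →ₗ[k] (List G → k)
  | 0 => LinearMap.id
  | 1 => mul1 (charX χ k)
  | n + 2 => mul2 (charY χ k) ∘ₗ power χ n

variable {S : Type*} {N : S → ℕ} (χ : ∀ i, G →* Multiplicative (ZMod (N i)))

/-- The monomial cocycle of multidegree `e` in the indices of the list, in the order of the list. -/
def mono (k : Type*) [CommRing k] (e : S → ℕ) : List S → List G → k
  | [] => unitC
  | i :: L => power (χ i) (e i) (mono k e L)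

theorem dL_unitC : dL (unitC : List G → k) = 0 := by
  ext l
  match l with
  | [] => rfl
  | [g] => simp
  | g :: h :: l =>
    have : (fun r => (unitC (g :: r) : k)) = 0 := rfl
    rw [dL_cons, dAux_cons, this, map_zero]
    simp [unitC]

theorem dL_power {N : ℕ} [NeZero N] (χ : G →* Multiplicative (ZMod N)) (hN : (N : k) = 0) (n : ℕ)
    {u : List G → k} (hu : dL u = 0) : dL (power χ n u) = 0 := by
  induction n using Nat.twoStepInduction with
  | zero => exact hu
  | one => simp [power, dL_mul1_charX χ hN, hu]
  | more n ih _ => simp [power, dL_mul2_charY, ih]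

theorem dL_mono [∀ i, NeZero (N i)] (hN : ∀ i, (N i : k) = 0) (e : S → ℕ) (L : List S) :
    dL (mono χ k e L) = 0 := by
  induction L with
  | nil => exact dL_unitC
  | cons i L ih => exact dL_power _ (hN i) _ ih

theorem power_apply_eq_zero {N : ℕ} (χ : G →* Multiplicative (ZMod N)) (n d : ℕ)
    {u : List G → k} (hu : ∀ l : List G, l.length ≠ d → u l = 0) (l : List G)
    (hl : l.length ≠ n + d) : power χ n u l = 0 := by
  induction n using Nat.twoStepInduction generalizing l with
  | zero => exact hu l (by simpa using hl)
  | one =>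
    cases l with
    | nil => rfl
    | cons g l => simp [power, hu l (by simpa [add_comm] using hl)]
  | more n ih _ =>
    match l with
    | [] => rfl
    | [g] => rfl
    | g :: h :: l =>
      simp only [power, LinearMap.comp_apply, mul2_cons]
      rw [ih l (by simp at hl; omega), mul_zero]

theorem mono_apply_eq_zero (e : S → ℕ) (L : List S) (l : List G)
    (hl : l.length ≠ (L.map e).sum) : mono χ k e L l = 0 := by
  induction L generalizing l with
  | nil =>
    cases l with
    | nil => simp at hl
    | cons g l => rfl
  | cons i L ih => exact power_apply_eq_zero _ _ _ ih l (by simpa using hl)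

theorem pull_power {N : ℕ} (χ : G →* Multiplicative (ZMod N)) (φ : H →* G) (n : ℕ)
    (u : List G → k) : pull φ (power χ n u) = power (χ.comp φ) n (pull φ u) := by
  induction n using Nat.twoStepInduction with
  | zero => rfl
  | one => exact pull_mul1 _ _ _
  | more n ih _ =>
    simp only [power, LinearMap.comp_apply, ← ih]
    exact pull_mul2 _ _ _

theorem pull_mono (φ : H →* G) (e : S → ℕ) (L : List S) :
    pull φ (mono χ k e L) = mono (fun i => (χ i).comp φ) k e L := by
  induction L with
  | nil => ext l; cases l <;> rfl
  | cons i L ih => simp only [mono, pull_power, ih]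

theorem mono_congr {χ χ' : ∀ i, G →* Multiplicative (ZMod (N i))} {e e' : S → ℕ} {L : List S}
    (hχ : ∀ i ∈ L, χ i = χ' i) (he : ∀ i ∈ L, e i = e' i) : mono χ k e L = mono χ' k e' L := by
  induction L with
  | nil => rfl
  | cons i L ih =>
    rw [mono, mono, hχ i (by simp), he i (by simp),
      ih (fun j hj => hχ j (by simp [hj])) fun j hj => he j (by simp [hj])]

/-- Indices at which the multidegree vanishes do not contribute. -/
theorem mono_filter (e : S → ℕ) (p : S → Bool) (L : List S) (h : ∀ i ∈ L, p i = false → e i = 0) :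
    mono χ k e (L.filter p) = mono χ k e L := by
  induction L with
  | nil => rfl
  | cons i L ih =>
    have ih := ih fun j hj => h j (by simp [hj])
    cases hp : p i with
    | false => rw [List.filter_cons_of_neg (by simp [hp]), ih, mono, h i (by simp) hp]; rfl
    | true => rw [List.filter_cons_of_pos hp, mono, mono, ih]

theorem power_eq_zero {N : ℕ} [NeZero N] (χ : G →* Multiplicative (ZMod N)) (h : χ = 1) {n : ℕ}
    (hn : n ≠ 0) (u : List G → k) : power χ n u = 0 := by
  subst h
  match n, hn with
  | 1, _ =>
    ext l
    cases l <;> simp [power, charX]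
  | n + 2, _ =>
    ext l
    match l with
    | [] => rfl
    | [g] => rfl
    | g :: h :: l => simp [power, charY]

theorem mono_eq_zero [∀ i, NeZero (N i)] (e : S → ℕ) {L : List S} {i : S} (hi : i ∈ L)
    (h : χ i = 1) (he : e i ≠ 0) : mono χ k e L = 0 := by
  induction L with
  | nil => simp at hi
  | cons j L ih =>
    rw [mono]
    rcases List.mem_cons.1 hi with rfl | hi
    · exact power_eq_zero _ h he _
    · rw [ih hi, map_zero]

/-- The characters `χ i`, for `i` in the list `L`, identify the commutative group `G` with a
product of cyclic groups. -/
structure IsCoordinates (L : List S) : Prop where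
  comm : ∀ a b : G, a * b = b * a
  eq_one : ∀ g : G, (∀ i ∈ L, χ i g = 1) → g = 1
  exists_eq : ∀ c : ∀ i, Multiplicative (ZMod (N i)), ∃ g : G, ∀ i ∈ L, χ i g = c i

variable {χ}

/-- A coordinate splits off its cyclic factor, and the other characters are coordinates of its kernel. -/
theorem IsCoordinates.exists_splitting {i : S} {L : List S} (h : IsCoordinates χ (i :: L))
    (hi : i ∉ L) :
    ∃ D : CyclicSplitting G (N i), D.χ = χ i ∧ (∀ j ∈ L, ∀ c, χ j (D.σ c) = 1) ∧
      IsCoordinates (fun j => (χ j).comp D.χ.ker.subtype) L := by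
  classical
  have hne : ∀ j ∈ L, j ≠ i := fun j hj => fun hji => hi (hji ▸ hj)
  choose f hf using fun c : Multiplicative (ZMod (N i)) =>
    h.exists_eq (Function.update 1 i c)
  have hf1 : ∀ c, χ i (f c) = c := fun c => by simpa using hf c i (by simp)
  have hf2 : ∀ c, ∀ j ∈ L, χ j (f c) = 1 := fun c j hj => by
    simpa [hne j hj] using hf c j (by simp [hj])
  have hext : ∀ a b : G, (∀ j ∈ i :: L, χ j a = χ j b) → a = b := fun a b hab =>
    mul_inv_eq_one.1 (h.eq_one _ fun j hj => by rw [map_mul, map_inv, hab j hj, mul_inv_cancel])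
  let D : CyclicSplitting G (N i) :=
    { χ := χ i
      σ :=
        { toFun := f
          map_one' := hext _ _ fun j hj => by
            rcases List.mem_cons.1 hj with rfl | hj
            · rw [hf1, map_one]
            · rw [hf2 _ j hj, map_one]
          map_mul' := fun a b => hext _ _ fun j hj => by
            rcases List.mem_cons.1 hj with rfl | hj
            · rw [map_mul, hf1, hf1, hf1]
            · rw [map_mul, hf2 _ j hj, hf2 _ j hj, hf2 _ j hj, mul_one] }
      χ_σ := hf1
      comm := h.comm }
  refine ⟨D, rfl, fun j hj c => hf2 c j hj, fun a b => Subtype.ext (h.comm a b), ?_, ?_⟩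
  · intro g hg
    refine Subtype.ext (h.eq_one _ fun j hj => ?_)
    rcases List.mem_cons.1 hj with rfl | hj
    · exact (MonoidHom.mem_ker).1 g.2
    · exact hg j hj
  · intro c
    obtain ⟨g, hg⟩ := h.exists_eq (Function.update c i 1)
    refine ⟨⟨g, (MonoidHom.mem_ker).2 ?_⟩, fun j hj => ?_⟩
    · simpa using hg i (by simp)
    · simpa [hne j hj] using hg j (by simp [hj])

/-- Inflating a monomial of the kernel of a coordinate gives the same monomial. -/
theorem infl_mono {M : ℕ} (D : CyclicSplitting G M) {L : List S}
    (hD : ∀ j ∈ L, ∀ c, χ j (D.σ c) = 1) (e : S → ℕ) :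
    D.infl (mono (fun j => (χ j).comp D.χ.ker.subtype) k e L) = mono χ k e L := by
  refine (pull_mono _ D.proj e L).trans (mono_congr (fun j hj => ?_) fun _ _ => rfl)
  ext g
  simp [CyclicSplitting.coe_proj, hD j hj]

end Monomials

/-! ### The monomials form a basis -/

section Dual

variable {k S : Type*} [CommRing k] {N : S → ℕ} [∀ i, NeZero (N i)]

open Classical in
/-- The monomials admit a dual family of functionals that vanish on coboundaries. For a list headed
by `i`, the functional for the kernel of `χ i` is composed with `restr` for the exponent `0`, with
`pr1` for the exponent `1`, and every further `pr2` raises the exponent by `2`. -/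
theorem exists_dual (hN : ∀ i, (N i : k) = 0) (hN1 : ∀ i, 1 < N i) (e : S → ℕ) {L : List S}
    (hL : L.Nodup) {G : Type*} [Group G] {χ : ∀ i, G →* Multiplicative (ZMod (N i))}
    (h : IsCoordinates χ L) :
    ∃ φ : (List G → k) →ₗ[k] k, (∀ m, φ (dL m) = 0) ∧
      ∀ e', φ (mono χ k e' L) = if ∀ j ∈ L, e j = e' j then 1 else 0 := by
  induction L generalizing G with
  | nil => exact ⟨LinearMap.proj [], fun m => rfl, fun e' => by simp [mono, unitC]⟩
  | cons i L ih =>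
    rw [List.nodup_cons] at hL
    obtain ⟨D, hχ, hσ, hA⟩ := h.exists_splitting hL.1
    obtain ⟨φ, hφ, hφm⟩ := ih hL.2 hA
    have hdA := dL_mono (fun j => (χ j).comp D.χ.ker.subtype) hN
    suffices key : ∀ n, ∃ ψ : (List G → k) →ₗ[k] k, (∀ m, ψ (dL m) = 0) ∧
        ∀ n' e', ψ (power D.χ n' (mono χ k e' L)) =
          if n = n' ∧ ∀ j ∈ L, e j = e' j then 1 else 0 by
      obtain ⟨ψ, hψ, hψm⟩ := key (e i)
      refine ⟨ψ, hψ, fun e' => ?_⟩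
      rw [mono, ← hχ, hψm]
      simp
    intro n
    induction n using Nat.twoStepInduction with
    | zero =>
      refine ⟨φ ∘ₗ D.restr, fun m => ?_, fun n' e' => ?_⟩
      · rw [LinearMap.comp_apply, ← D.dL_restr, hφ]
      · match n' with
        | 0 => simp [power, ← infl_mono D hσ, hφm]
        | 1 => simp [power, D.restr_mul1]
        | n' + 2 => simp [power, D.restr_mul2]
    | one =>
      refine ⟨φ ∘ₗ D.pr1, fun m => ?_, fun n' e' => ?_⟩
      · obtain ⟨m', hm'⟩ := D.pr1_dL m
        rw [LinearMap.comp_apply, hm', hφ]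
      · match n' with
        | 0 => simp [power, ← infl_mono D hσ, D.pr1_infl]
        | 1 =>
          obtain ⟨m, hm⟩ := D.pr1_mul1_infl (hN i) (hN1 i) (hdA e' L)
          simp [power, ← infl_mono D hσ, hm, hφ, hφm]
        | n' + 2 =>
          obtain ⟨m, hm⟩ := D.pr1_mul2 (dL_power D.χ (hN i) n' (dL_mono χ hN e' L))
          simp [power, hm, hφ]
    | more n ih _ =>
      obtain ⟨ψ, hψ, hψm⟩ := ih
      refine ⟨ψ ∘ₗ D.pr2, fun m => ?_, fun n' e' => ?_⟩
      · obtain ⟨m', hm'⟩ := D.pr2_dL (hN i) m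
        rw [LinearMap.comp_apply, hm', hψ]
      · match n' with
        | 0 => simp [power, ← infl_mono D hσ, D.pr2_infl]
        | 1 =>
          obtain ⟨m, hm⟩ := D.pr2_mul1_infl (hN i) (hN1 i) (hdA e' L)
          simp [power, ← infl_mono D hσ, hm, hψ]
        | n' + 2 =>
          obtain ⟨m, hm⟩ := D.pr2_mul2 (hN i) (hN1 i) (dL_power D.χ (hN i) n' (dL_mono χ hN e' L))
          simp [power, hm, hψ, hψm]

/-- The trivial group has no cohomology in positive degrees. -/
theorem eq_unitC_add_dL {G : Type*} [Group G] (hG : ∀ g : G, g = 1) {f : List G → k}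
    (hf : dL f = 0) : f = f [] • unitC + dL fun l => f (1 :: l) := by
  ext l
  cases l with
  | nil => simp [unitC]
  | cons g l =>
    have := congrFun hf (1 :: 1 :: l)
    rw [hG g]
    simp only [dL_cons, dAux_cons, mul_one, Pi.zero_apply] at this
    simp only [Pi.add_apply, Pi.smul_apply, unitC, dL_cons, smul_zero]
    linear_combination this

theorem map_mem_of_mem_span_range {ι V W : Type*} [AddCommGroup V] [Module k V] [AddCommGroup W]
    [Module k W] (f : V →ₗ[k] W) (w : ι → V) (p : Submodule k W) (h : ∀ i, f (w i) ∈ p) {v : V}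
    (hv : v ∈ Submodule.span k (Set.range w)) : f v ∈ p := by
  have : Submodule.span k (Set.range w) ≤ p.comap f :=
    Submodule.span_le.2 (by rintro _ ⟨i, rfl⟩; exact h i)
  exact this hv

/-- The monomials generate the cohomology in each degree. The splitting of the first coordinate
decomposes a cocycle into two cocycles of the kernel and a cocycle of the whole group whose degree is
lower by `2`. The bound `n` on the degree makes this recursion terminate on total cocycles, which may
have nonzero components in all degrees. -/
theorem exists_span (hN : ∀ i, (N i : k) = 0) (hN1 : ∀ i, 1 < N i) {L : List S}
    (hL : L.Nodup) {G : Type*} [Group G] {χ : ∀ i, G →* Multiplicative (ZMod (N i))}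
    (h : IsCoordinates χ L) (n : ℕ) {f : List G → k} (hf : dL f = 0) :
    ∃ v ∈ Submodule.span k (Set.range fun e => mono χ k e L), ∃ m : List G → k,
      ∀ l : List G, l.length < n → f l = v l + dL m l := by
  classical
  induction L generalizing G n with
  | nil =>
    refine ⟨f [] • unitC, Submodule.smul_mem _ _ (Submodule.subset_span ⟨0, rfl⟩), _,
      fun l _ => congrFun (eq_unitC_add_dL (fun g => h.eq_one g (by simp)) hf) l⟩
  | cons i L ih =>
    rw [List.nodup_cons] at hL
    obtain ⟨D, hχ, hσ, hA⟩ := h.exists_splitting hL.1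
    have hup : ∀ (e : S → ℕ) n, mono χ k (Function.update e i n) (i :: L) =
        power D.χ n (mono χ k e L) := by
      intro e n
      rw [mono, hχ, Function.update_self]
      congr 1
      refine mono_congr (fun _ _ => rfl) fun j hj => Function.update_of_ne ?_ _ _
      rintro rfl
      exact hL.1 hj
    have hs0 : ∀ v ∈ Submodule.span k
        (Set.range fun e => mono (fun j => (χ j).comp D.χ.ker.subtype) k e L),
        D.infl v ∈ Submodule.span k (Set.range fun e => mono χ k e (i :: L)) := by
      intro v hv
      refine map_mem_of_mem_span_range D.infl _ _ (fun e => ?_) hv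
      refine Submodule.subset_span ⟨Function.update e i 0, ?_⟩
      simp only [hup, infl_mono D hσ]
      rfl
    have hs1 : ∀ v ∈ Submodule.span k
        (Set.range fun e => mono (fun j => (χ j).comp D.χ.ker.subtype) k e L),
        mul1 (charX D.χ k) (D.infl v) ∈
          Submodule.span k (Set.range fun e => mono χ k e (i :: L)) := by
      intro v hv
      refine map_mem_of_mem_span_range (mul1 (charX D.χ k) ∘ₗ D.infl) _ _ (fun e => ?_) hv
      refine Submodule.subset_span ⟨Function.update e i 1, ?_⟩
      simp only [hup, infl_mono D hσ, LinearMap.comp_apply]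
      rfl
    have hs2 : ∀ v ∈ Submodule.span k (Set.range fun e => mono χ k e (i :: L)),
        mul2 (charY D.χ k) v ∈ Submodule.span k (Set.range fun e => mono χ k e (i :: L)) := by
      intro v hv
      refine map_mem_of_mem_span_range (mul2 (charY D.χ k)) _ _ (fun e => ?_) hv
      refine Submodule.subset_span ⟨Function.update e i (e i + 2), ?_⟩
      simp only [hup]
      rw [mono, hχ]
      rfl
    induction n using Nat.strong_induction_on generalizing f with
    | _ n ihn =>
      rcases Nat.eq_zero_or_pos n with rfl | hn
      · exact ⟨0, Submodule.zero_mem _, 0, by simp⟩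
      obtain ⟨ha, hu, m, hm⟩ := D.exists_decomposition (hN i) (hN1 i) hf
      obtain ⟨v0, hv0, m0, h0⟩ := ih hL.2 hA n (f := D.restr f) (by rw [D.dL_restr, hf, map_zero])
      obtain ⟨v1, hv1, m1, h1⟩ := ih hL.2 hA (n - 1) ha
      obtain ⟨v2, hv2, m2, h2⟩ := ihn (n - 2) (by omega) hu
      refine ⟨D.infl v0 + mul1 (charX D.χ k) (D.infl v1) + mul2 (charY D.χ k) v2,
        Submodule.add_mem _ (Submodule.add_mem _ (hs0 _ hv0) (hs1 _ hv1)) (hs2 _ hv2),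
        D.infl m0 - mul1 (charX D.χ k) (D.infl m1) + mul2 (charY D.χ k) m2 + m, fun l hl => ?_⟩
      have e0 : D.infl (D.restr f) l = D.infl v0 l + D.infl (dL m0) l :=
        h0 _ (by simpa using hl)
      have e1 : mul1 (charX D.χ k) (D.infl (D.pr1 f)) l =
          mul1 (charX D.χ k) (D.infl v1) l + mul1 (charX D.χ k) (D.infl (dL m1)) l := by
        cases l with
        | nil => simp
        | cons g l =>
          simp only [List.length_cons] at hl
          simp only [mul1_cons, CyclicSplitting.infl_apply, ← mul_add]
          rw [h1 _ (by simp; omega)]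
      have e2 : mul2 (charY D.χ k) (D.pr2 f) l =
          mul2 (charY D.χ k) v2 l + mul2 (charY D.χ k) (dL m2) l := by
        match l, hl with
        | [], _ => simp
        | [g], _ => simp
        | g :: h :: l, hl =>
          simp only [List.length_cons] at hl
          simp only [mul2_cons, ← mul_add]
          rw [h2 _ (by omega)]
      conv_lhs => rw [hm]
      simp only [map_add, map_sub, dL_mul1_charX _ (hN i), dL_mul2_charY, D.dL_infl, Pi.add_apply,
        Pi.sub_apply, Pi.neg_apply, e0, e1, e2]
      ring

end Dual

open CupProduct

/-! ### Comparison with group cohomology -/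

section Comparison

variable {k G : Type} [CommRing k] [Group G]

/-- The component of degree `n` of a total cochain. -/
def toFin (n : ℕ) : (List G → k) →ₗ[k] ((Fin n → G) → k) := LinearMap.funLeft k k List.ofFn

omit [Group G] in
@[simp] theorem toFin_apply (n : ℕ) (u : List G → k) (x : Fin n → G) :
    toFin n u x = u (List.ofFn x) := rfl

/-- The total cochain concentrated in degree `n` with a given component. -/
def ofFin (n : ℕ) (f : (Fin n → G) → k) (l : List G) : k :=
  if h : l.length = n then f (fun i => l.get (Fin.cast h.symm i)) else 0

omit [Group G] in
theorem toFin_ofFin (n : ℕ) (f : (Fin n → G) → k) : toFin n (ofFin n f) = f := by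
  ext x
  rw [toFin_apply, ofFin, dif_pos (by simp)]
  congr 1
  ext i
  simp

omit [Group G] in
theorem ofFin_of_length_ne {n : ℕ} (f : (Fin n → G) → k) {l : List G} (h : l.length ≠ n) :
    ofFin n f l = 0 := dif_neg h

omit [Group G] in
theorem toFin_ofFin_of_ne {m n : ℕ} (h : m ≠ n) (f : (Fin n → G) → k) :
    toFin m (ofFin n f) = 0 := by
  ext x
  exact ofFin_of_length_ne _ (by simpa using h)

omit [Group G] in
theorem ext_toFin {u v : List G → k} (h : ∀ n, toFin n u = toFin n v) : u = v := by
  ext l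
  have := congrFun (h l.length) l.get
  simpa using this

omit [CommRing k] in
theorem contractNth_zero {n : ℕ} (x : Fin (n + 2) → G) :
    List.ofFn (Fin.contractNth 0 (· * ·) x) =
      x 0 * x 1 :: List.ofFn (fun i : Fin n => x i.succ.succ) := by
  rw [List.ofFn_succ]
  rfl

omit [CommRing k] in
theorem contractNth_succ {n : ℕ} (j : Fin (n + 1)) (x : Fin (n + 2) → G) :
    List.ofFn (Fin.contractNth j.succ (· * ·) x) =
      x 0 :: List.ofFn (Fin.contractNth j (· * ·) fun i => x i.succ) := by
  rw [List.ofFn_succ]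
  congr 1
  congr 1
  ext i
  simp [Fin.contractNth]

theorem dAux_ofFn {n : ℕ} (x : Fin (n + 1) → G) (u : List G → k) :
    dAux (x 0) (List.ofFn fun i : Fin n => x i.succ) u =
      ∑ j : Fin (n + 1), (-1 : k) ^ (j : ℕ) * u (List.ofFn (Fin.contractNth j (· * ·) x)) := by
  induction n generalizing u with
  | zero => simp
  | succ n ih =>
    rw [Fin.sum_univ_succ, List.ofFn_succ, dAux_cons, contractNth_zero]
    have := ih (fun i => x i.succ) fun r => u (x 0 :: r)
    refine (congrArg _ this).trans ?_
    simp only [contractNth_succ, Fin.val_zero, pow_zero, one_mul, Fin.val_succ, pow_succ]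
    simp [sub_eq_add_neg]

theorem dC_toFin (n : ℕ) (u : List G → k) : dC k G n (toFin n u) = toFin (n + 1) (dL u) := by
  refine funext fun x => ?_
  rw [dC_apply, toFin_apply, toFin_apply, List.ofFn_succ, dL_cons, dAux_ofFn]
  simp [pow_succ, sub_eq_add_neg]

theorem dL_eq_zero_of_ofFin {n : ℕ} {f : (Fin n → G) → k} (h : dC k G n f = 0) :
    dL (ofFin n f) = 0 := by
  refine ext_toFin fun m => ?_
  cases m with
  | zero => ext x; simp
  | succ m =>
    rw [← dC_toFin, map_zero]
    rcases eq_or_ne m n with rfl | hm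
    · rw [toFin_ofFin, h]
    · rw [toFin_ofFin_of_ne hm, map_zero]

/-- The cohomology class in degree `n` of a total cocycle. -/
def clsL (n : ℕ) : LinearMap.ker (dL (G := G) (k := k)) →ₗ[k] H k G n :=
  cls n ∘ₗ
    { toFun := fun u => mkZ n (toFin n u.1) (by rw [dC_toFin, (LinearMap.mem_ker).1 u.2, map_zero])
      map_add' := fun u v => toC_injective _ (by simp [toC_mkZ])
      map_smul' := fun c u => toC_injective _ (by simp [toC_mkZ]) }

theorem clsL_apply (n : ℕ) (u : LinearMap.ker (dL (G := G) (k := k))) :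
    clsL n u = cls n (mkZ n (toFin n u.1)
      (by rw [dC_toFin, (LinearMap.mem_ker).1 u.2, map_zero])) := rfl

theorem clsL_eq_zero {n : ℕ} (u : LinearMap.ker (dL (G := G) (k := k))) (m : List G → k)
    (h : ∀ l : List G, l.length = n → u.1 l = dL m l) : clsL n u = 0 := by
  have h' : toFin n u.1 = toFin n (dL m) := by
    ext x
    exact h _ (by simp)
  cases n with
  | zero =>
    rw [clsL_apply, cls_zero_eq_zero_iff]
    refine toC_injective _ ?_
    rw [toC_mkZ, h', map_zero]
    ext x
    simp
  | succ n =>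
    rw [clsL_apply, cls_succ_eq_zero_iff]
    exact ⟨toFin n m, by rw [toC_mkZ, h', dC_toFin]⟩

/-- A total cocycle concentrated in degree `n` with trivial class is a coboundary. -/
theorem exists_dL_eq_of_clsL_eq_zero {n : ℕ} (u : LinearMap.ker (dL (G := G) (k := k)))
    (hu : ∀ l : List G, l.length ≠ n → u.1 l = 0) (h : clsL n u = 0) :
    ∃ m, u.1 = dL m := by
  have hu' : ∀ m, m ≠ n → toFin m u.1 = 0 := fun m hm => by
    ext x
    exact hu _ (by simpa using hm)
  rw [clsL_apply] at h
  cases n with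
  | zero =>
    rw [cls_zero_eq_zero_iff] at h
    have h0 : toFin 0 u.1 = 0 := by
      rw [← toC_mkZ 0 (toFin 0 u.1) (by rw [dC_toFin, (LinearMap.mem_ker).1 u.2, map_zero]), h,
        map_zero]
    refine ⟨0, ext_toFin fun m => ?_⟩
    rcases eq_or_ne m 0 with rfl | hm
    · rw [h0, map_zero, map_zero]
    · rw [hu' m hm, map_zero, map_zero]
  | succ n =>
    rw [cls_succ_eq_zero_iff, toC_mkZ] at h
    obtain ⟨f, hf⟩ := h
    refine ⟨ofFin n f, ext_toFin fun m => ?_⟩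
    cases m with
    | zero =>
      rw [hu' 0 (by simp)]
      ext x
      simp
    | succ m =>
      rw [← dC_toFin]
      rcases eq_or_ne m n with rfl | hm
      · rw [toFin_ofFin, hf]
      · rw [toFin_ofFin_of_ne hm, map_zero, hu' _ (by simpa using hm)]

/-- Every class is represented by a total cocycle concentrated in its degree. -/
theorem exists_clsL_eq (n : ℕ) (x : H k G n) :
    ∃ u : LinearMap.ker (dL (G := G) (k := k)),
      (∀ l : List G, l.length ≠ n → u.1 l = 0) ∧ clsL n u = x := by
  obtain ⟨z, rfl⟩ := cls_surjective n x
  refine ⟨⟨ofFin n (toC n z), (LinearMap.mem_ker).2 (dL_eq_zero_of_ofFin (dC_toC n z))⟩,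
    fun l hl => ofFin_of_length_ne _ hl, ?_⟩
  rw [clsL_apply]
  congr 1
  refine toC_injective _ ?_
  rw [toC_mkZ, toFin_ofFin]

theorem toC_cocyclesMap (K : Subgroup G) (n : ℕ)
    (z : groupCohomology.cocycles (Rep.trivial k G k) n) :
    toC n ((groupCohomology.cocyclesMap (A := Rep.trivial k G k) (B := Rep.trivial k K k) K.subtype
      (Rep.ofHom ⟨LinearMap.id, fun _ => rfl⟩) n).hom z) =
      fun x => toC n z (fun i => (x i : G)) := by
  have h := HomologicalComplex.cyclesMap_i (groupCohomology.cochainsMap (A := Rep.trivial k G k)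
    (B := Rep.trivial k K k) K.subtype (Rep.ofHom ⟨LinearMap.id, fun _ => rfl⟩)) n
  exact congrArg (fun φ => φ.hom z) h

theorem res_cls (K : Subgroup G) (n : ℕ)
    (z : groupCohomology.cocycles (Rep.trivial k G k) n) :
    res k K n (cls n z) =
      cls n ((groupCohomology.cocyclesMap (A := Rep.trivial k G k) (B := Rep.trivial k K k)
        K.subtype (Rep.ofHom ⟨LinearMap.id, fun _ => rfl⟩) n).hom z) := by
  have h := groupCohomology.π_map (A := Rep.trivial k G k) (B := Rep.trivial k K k) K.subtype
    (Rep.ofHom ⟨LinearMap.id, fun _ => rfl⟩) n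
  exact congrArg (fun φ => φ.hom z) h

theorem dL_pull_subtype (K : Subgroup G) {u : List G → k} (hu : dL u = 0) :
    dL (pull (K.subtype : K → G) u) = 0 := by
  rw [dL_pull _ (fun _ _ => rfl), hu, map_zero]

theorem res_clsL (K : Subgroup G) (n : ℕ) {u : List G → k} (hu : dL u = 0) :
    res k K n (clsL n ⟨u, hu⟩) = clsL n ⟨pull K.subtype u, dL_pull_subtype K hu⟩ := by
  rw [clsL_apply, clsL_apply, res_cls]
  congr 1
  refine toC_injective _ ?_
  rw [toC_cocyclesMap, toC_mkZ, toC_mkZ]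
  ext x
  simp [List.map_ofFn, Function.comp_def]

end Comparison

/-! ### The cohomology ring -/

section Ring

variable {k G : Type} [CommRing k] [Group G]

theorem of_cls_eq {n m : ℕ} (h : n = m) (a : groupCohomology.cocycles (Rep.trivial k G k) n)
    (b : groupCohomology.cocycles (Rep.trivial k G k) m)
    (hab : ∀ x : Fin n → G, toC n a x = toC m b (fun i => x (Fin.cast h.symm i))) :
    DirectSum.of (fun n => H k G n) n (cls n a) = DirectSum.of (fun n => H k G n) m (cls m b) := by
  subst h
  rw [toC_injective _ (funext hab)]

/-- The unit of the cohomology ring. -/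
def oneStar : HStar k G :=
  DirectSum.of (fun n => H k G n) 0 (clsL 0 ⟨unitC, (LinearMap.mem_ker).2 dL_unitC⟩)

theorem cupStar_assoc (x y z : HStar k G) :
    cupStar (cupStar x y) z = cupStar x (cupStar y z) := by
  induction x using DirectSum.induction_on with
  | zero => simp
  | add x x' hx hx' => simp only [map_add, LinearMap.add_apply, hx, hx']
  | of p x =>
    induction y using DirectSum.induction_on with
    | zero => simp
    | add x x' hx hx' => simp only [map_add, LinearMap.add_apply, hx, hx']
    | of q y =>
      induction z using DirectSum.induction_on with
      | zero => simp
      | add x x' hx hx' => simp only [map_add, hx, hx']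
      | of r z =>
        obtain ⟨a, rfl⟩ := cls_surjective p x
        obtain ⟨b, rfl⟩ := cls_surjective q y
        obtain ⟨c, rfl⟩ := cls_surjective r z
        simp only [cupStar_of, cup_cls]
        refine of_cls_eq (add_assoc p q r) _ _ fun x => ?_
        simp only [toC_cupZ, cupC_apply, mul_assoc, Fin.cast_mk, add_assoc]

theorem one_cupStar (x : HStar k G) : cupStar oneStar x = x := by
  induction x using DirectSum.induction_on with
  | zero => simp
  | add x x' hx hx' => simp only [map_add, hx, hx']
  | of p x =>
    obtain ⟨a, rfl⟩ := cls_surjective p x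
    rw [oneStar, clsL_apply, cupStar_of, cup_cls]
    refine of_cls_eq (zero_add p) _ _ fun x => ?_
    simp [toC_cupZ, cupC_apply, toC_mkZ, unitC, Fin.cast]

theorem cupStar_one (x : HStar k G) : cupStar x oneStar = x := by
  induction x using DirectSum.induction_on with
  | zero => simp
  | add x x' hx hx' => simp only [map_add, LinearMap.add_apply, hx, hx']
  | of p x =>
    obtain ⟨a, rfl⟩ := cls_surjective p x
    rw [oneStar, clsL_apply, cupStar_of, cup_cls]
    refine of_cls_eq (add_zero p) _ _ fun x => ?_
    refine (congrFun (toC_cupZ a _) x).trans ?_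
    simp [cupC_apply, toC_mkZ, unitC, Fin.cast]

/-- The cohomology ring of a group. -/
scoped instance cohomologyRing : Ring (HStar k G) where
  __ := (inferInstance : AddCommGroup (HStar k G))
  mul x y := cupStar x y
  one := oneStar
  mul_assoc := cupStar_assoc
  one_mul := one_cupStar
  mul_one := cupStar_one
  left_distrib x y z := (cupStar x).map_add y z
  right_distrib x y z := by
    change cupStar (x + y) z = cupStar x z + cupStar y z
    rw [map_add, LinearMap.add_apply]
  zero_mul x := by
    change cupStar 0 x = 0
    rw [map_zero, LinearMap.zero_apply]
  mul_zero x := (cupStar x).map_zero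

theorem cupStar_eq_mul (x y : HStar k G) : cupStar x y = x * y := rfl

/-- The scalar multiplication of the algebra is that of the direct sum of the cohomology groups. -/
scoped instance cohomologyAlgebra : Algebra k (HStar k G) :=
  Algebra.ofModule (fun c x y => by
      change cupStar (c • x) y = c • cupStar x y
      rw [map_smul, LinearMap.smul_apply])
    (fun c x y => (cupStar x).map_smul c y)

end Ring

/-! ### Relations between the generators -/

section Relations

variable {k G : Type} [CommRing k] [Group G]

/-- The class in the cohomology ring of the component of degree `n` of a total cocycle. -/
def clsStar (n : ℕ) (u : List G → k) (hu : dL u = 0) : HStar k G :=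
  DirectSum.of (fun n => H k G n) n (clsL n ⟨u, (LinearMap.mem_ker).2 hu⟩)

theorem clsStar_eq_of_sub {n : ℕ} {u v : List G → k} (hu : dL u = 0) (hv : dL v = 0)
    (m : List G → k) (h : ∀ l : List G, l.length = n → u l - v l = dL m l) :
    clsStar n u hu = clsStar n v hv := by
  have := clsL_eq_zero (n := n) (⟨u, (LinearMap.mem_ker).2 hu⟩ - ⟨v, (LinearMap.mem_ker).2 hv⟩) m h
  rw [map_sub, sub_eq_zero] at this
  rw [clsStar, clsStar, this]

theorem clsStar_smul {n : ℕ} (c : k) {u : List G → k} (hu : dL u = 0) :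
    clsStar n (c • u) (by rw [map_smul, hu, smul_zero]) = c • clsStar n u hu := by
  have := (clsL n).map_smul c (⟨u, (LinearMap.mem_ker).2 hu⟩ : LinearMap.ker (dL (G := G) (k := k)))
  simp only [clsStar, ← DirectSum.lof_eq_of k, ← (DirectSum.lof k ℕ _ _).map_smul, ← this]
  rfl

theorem clsStar_congr {n n' : ℕ} {u v : List G → k} (hu : dL u = 0) (h : n = n') (huv : u = v) :
    clsStar n u hu = clsStar n' v (huv ▸ hu) := by
  subst h huv
  rfl

theorem clsStar_mul_eq {p q n : ℕ} (hn : p + q = n) {u v w : List G → k} (hu : dL u = 0)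
    (hv : dL v = 0) (hw : dL w = 0)
    (h : ∀ x : Fin (p + q) → G, u (List.ofFn fun i : Fin p => x (Fin.castAdd q i)) *
      v (List.ofFn fun i : Fin q => x (Fin.natAdd p i)) = w (List.ofFn x)) :
    clsStar p u hu * clsStar q v hv = clsStar n w hw := by
  subst hn
  rw [clsStar, clsStar, clsStar, ← cupStar_eq_mul, clsL_apply, clsL_apply, clsL_apply, cupStar_of, cup_cls]
  refine of_cls_eq rfl _ _ fun x => ?_
  rw [toC_cupZ, cupC_apply, toC_mkZ, toC_mkZ, toC_mkZ]
  exact h x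

theorem dL_mul1_eq_zero {a : G → k} (ha : ∀ g h, a (g * h) = a g + a h) {u : List G → k}
    (hu : dL u = 0) : dL (mul1 a u) = 0 := by
  rw [dL_mul1 a ha, hu, map_zero, neg_zero]

theorem dL_mul2_eq_zero {b : G → G → k}
    (hb : ∀ g h j, b h j + b g (h * j) = b (g * h) j + b g h) {u : List G → k}
    (hu : dL u = 0) : dL (mul2 b u) = 0 := by
  rw [dL_mul2 b hb, hu, map_zero]

/-- The class of a homomorphism to the coefficients. -/
def cls1 (a : G → k) (ha : ∀ g h, a (g * h) = a g + a h) : HStar k G :=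
  clsStar 1 (mul1 a unitC) (dL_mul1_eq_zero ha dL_unitC)

/-- The class of an inhomogeneous `2`-cocycle. -/
def cls2 (b : G → G → k) (hb : ∀ g h j, b h j + b g (h * j) = b (g * h) j + b g h) : HStar k G :=
  clsStar 2 (mul2 b unitC) (dL_mul2_eq_zero hb dL_unitC)

theorem cls1_mul {a : G → k} (ha : ∀ g h, a (g * h) = a g + a h) {n : ℕ} {u : List G → k}
    (hu : dL u = 0) :
    cls1 a ha * clsStar n u hu = clsStar (n + 1) (mul1 a u) (dL_mul1_eq_zero ha hu) := by
  refine clsStar_mul_eq (add_comm 1 n) _ _ _ fun x => ?_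
  have : List.ofFn x = x (Fin.castAdd n 0) :: List.ofFn fun i : Fin n => x (Fin.natAdd 1 i) := by
    rw [List.ofFn_add]
    rfl
  rw [this]
  simp [unitC]

theorem cls2_mul {b : G → G → k} (hb : ∀ g h j, b h j + b g (h * j) = b (g * h) j + b g h) {n : ℕ}
    {u : List G → k} (hu : dL u = 0) :
    cls2 b hb * clsStar n u hu = clsStar (n + 2) (mul2 b u) (dL_mul2_eq_zero hb hu) := by
  refine clsStar_mul_eq (add_comm 2 n) _ _ _ fun x => ?_
  have : List.ofFn x = x (Fin.castAdd n 0) :: x (Fin.castAdd n 1) ::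
      List.ofFn fun i : Fin n => x (Fin.natAdd 2 i) := by
    rw [List.ofFn_add]
    rfl
  rw [this]
  simp [unitC]

theorem clsStar_unitC : clsStar 0 (unitC : List G → k) dL_unitC = 1 := rfl

theorem cls1_anticomm {a a' : G → k} (ha : ∀ g h, a (g * h) = a g + a h)
    (ha' : ∀ g h, a' (g * h) = a' g + a' h) : cls1 a ha * cls1 a' ha' = -(cls1 a' ha' * cls1 a ha) := by
  have e1 := cls1_mul ha (dL_mul1_eq_zero ha' dL_unitC) (n := 1)
  have e2 := cls1_mul ha' (dL_mul1_eq_zero ha dL_unitC) (n := 1)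
  rw [show cls1 a ha * cls1 a' ha' = _ from e1, show cls1 a' ha' * cls1 a ha = _ from e2,
    ← neg_one_smul k, ← clsStar_smul]
  -- The product of two homomorphisms bounds the sum of their two cup products.
  refine clsStar_eq_of_sub _ _ (fun l => match l with | [g] => -(a g * a' g) | _ => 0) ?_
  intro l hl
  match l, hl with
  | [g, h], _ =>
    simp [unitC, ha, ha']
    ring

theorem cls1_comm_cls2 {a : G → k} {b : G → G → k} (ha : ∀ g h, a (g * h) = a g + a h)
    (hb : ∀ g h j, b h j + b g (h * j) = b (g * h) j + b g h) :
    cls1 a ha * cls2 b hb = cls2 b hb * cls1 a ha := by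
  have e1 := cls1_mul ha (dL_mul2_eq_zero hb dL_unitC) (n := 2)
  have e2 := cls2_mul hb (dL_mul1_eq_zero ha dL_unitC) (n := 1)
  rw [show cls1 a ha * cls2 b hb = _ from e1, show cls2 b hb * cls1 a ha = _ from e2]
  -- The bounding cochain is the cup-one product of the two cocycles.
  refine clsStar_eq_of_sub _ _ (fun l => match l with | [g, h] => -(a (g * h) * b g h) | _ => 0) ?_
  intro l hl
  match l, hl with
  | [g, h, j], _ =>
    simp [unitC, ha]
    linear_combination (a g + a h + a j) * hb g h j

theorem cls2_comm {b b' : G → G → k}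
    (hb : ∀ g h j, b h j + b g (h * j) = b (g * h) j + b g h)
    (hb' : ∀ g h j, b' h j + b' g (h * j) = b' (g * h) j + b' g h) :
    cls2 b hb * cls2 b' hb' = cls2 b' hb' * cls2 b hb := by
  have e1 := cls2_mul hb (dL_mul2_eq_zero hb' dL_unitC) (n := 2)
  have e2 := cls2_mul hb' (dL_mul2_eq_zero hb dL_unitC) (n := 2)
  rw [show cls2 b hb * cls2 b' hb' = _ from e1, show cls2 b' hb' * cls2 b hb = _ from e2]
  -- The bounding cochain is the cup-one product of the two cocycles.
  refine clsStar_eq_of_sub _ _ (fun l => match l with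
    | [g, h, j] => b g (h * j) * b' h j - b (g * h) j * b' g h | _ => 0) ?_
  intro l hl
  match l, hl with
  | [g, h, j, t], _ =>
    simp [unitC, mul_assoc]
    have h1 := hb' g h j
    have h2 := hb (g * h) j t
    have h3 := hb g (h * j) t
    have h4 := hb' h j t
    have h5 := hb g h (j * t)
    simp only [mul_assoc] at h1 h2 h3 h4 h5
    linear_combination b (g * (h * j)) t * h1 - b' g h * h2 + b' h j * h3 + b g (h * (j * t)) * h4
      - b' j t * h5

theorem choose_two_add (a b : ℕ) : (a + b).choose 2 = a.choose 2 + b.choose 2 + a * b := by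
  induction b with
  | zero => simp
  | succ b ih =>
    rw [← add_assoc, Nat.choose_succ_succ' _ 1, ih, Nat.choose_succ_succ' b 1]
    simp
    ring

theorem two_mul_choose_two_add (n : ℕ) : 2 * n.choose 2 + n = n * n := by
  induction n with
  | zero => simp
  | succ n ih =>
    rw [Nat.choose_succ_succ' n 1, Nat.choose_one_right]
    linarith

theorem carry_le_one {N : ℕ} [NeZero N] (a b : ZMod N) : carry a b ≤ 1 := by
  have ha := ZMod.val_lt a
  have hb := ZMod.val_lt b
  exact Nat.lt_succ_iff.1 ((Nat.div_lt_iff_lt_mul (NeZero.pos N)).2 (by omega))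

/-- The square of the generator in degree `1` is `N / 2` times the generator in degree `2`. -/
theorem cls1_charX_sq {N n : ℕ} [NeZero N] (hNn : N = 2 * n) (hN : (N : k) = 0)
    (χ : G →* Multiplicative (ZMod N)) :
    cls1 (charX χ k) (charX_mul χ hN) * cls1 (charX χ k) (charX_mul χ hN) =
      (n : k) • cls2 (charY χ k) (charY_cocycle χ) := by
  have e1 := cls1_mul (charX_mul χ hN) (dL_mul1_eq_zero (charX_mul χ hN) dL_unitC) (n := 1)
  rw [show cls1 (charX χ k) (charX_mul χ hN) * cls1 (charX χ k) (charX_mul χ hN) = _ from e1,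
    cls2, ← clsStar_smul]
  -- With `A`, `B` the residues of two arguments and `t` their carry, `A + B = N t + C`, and `x ∪ x` is
  -- `A B = (A + B).choose 2 - A.choose 2 - B.choose 2`, where `(N t + C).choose 2 = C.choose 2 + n t`
  -- in `k`.
  refine clsStar_eq_of_sub _ _ (fun l => match l with
    | [g] => -(((χ g).toAdd.val.choose 2 : ℕ) : k) | _ => 0) ?_
  intro l hl
  match l, hl with
  | [g, h], _ =>
    simp only [mul1_cons, mul2_cons, unitC, dL_cons, dAux_cons, dAux_nil, Pi.smul_apply, mul_one,
      smul_eq_mul, charX, charY, map_mul, toAdd_mul]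
    have hc := mul_carry_add (χ g).toAdd (χ h).toAdd
    have hc1 := carry_le_one (χ g).toAdd (χ h).toAdd
    generalize carry (χ g).toAdd (χ h).toAdd = t at *
    generalize ((χ g).toAdd + (χ h).toAdd).val = C at *
    generalize (χ g).toAdd.val = A at *
    generalize (χ h).toAdd.val = B at *
    have h2 : (n : k) * 2 = 0 := by
      rw [← hN, hNn]
      push_cast
      ring
    have hAB := congrArg (Nat.cast (R := k)) (choose_two_add A B)
    rw [← hc] at hAB
    interval_cases t
    · rw [mul_zero, zero_add] at hAB
      push_cast at hAB ⊢
      linear_combination -hAB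
    · have h3 := congrArg (Nat.cast (R := k)) (choose_two_add n n)
      have h4 := congrArg (Nat.cast (R := k)) (two_mul_choose_two_add n)
      rw [mul_one, choose_two_add, hNn, two_mul] at hAB
      push_cast at hAB h3 h4 ⊢
      linear_combination -hAB + h3 + h4 + ((n : k) + C - 1) * h2

end Relations

/-! ### Products of ordered monomials -/

section Algebra

variable {R k S : Type*} [CommRing k] [Ring R] [Algebra k R] (X Y : S → R)

/-- The powers of the generators `x` and `y` of a cyclic factor, as in `power`. -/
def zpow (i : S) : ℕ → R
  | 0 => 1
  | 1 => X i
  | n + 2 => Y i * zpow i n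

/-- The product in the order of the list of the generators raised to the exponents `e`. -/
def zprod (e : S → ℕ) (L : List S) : R := (L.map fun i => zpow X Y i (e i)).prod

/-- The sum of `e i * e' j` over the pairs for which `j` occurs before `i` in the list. -/
def omegaList (e e' : S → ℕ) : List S → ℕ
  | [] => 0
  | i :: L => (L.map e).sum * e' i + omegaList e e' L

variable {X Y} {n : S → k} (hXX : ∀ i j, X i * X j = -(X j * X i))
  (hXY : ∀ i j, X i * Y j = Y j * X i) (hYY : ∀ i j, Y i * Y j = Y j * Y i)
  (hsq : ∀ i, X i * X i = n i • Y i)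

include hXY hYY in
theorem zpow_mul_Y (i j : S) (a : ℕ) : zpow X Y i a * Y j = Y j * zpow X Y i a := by
  induction a using Nat.twoStepInduction with
  | zero => simp [zpow]
  | one => exact hXY i j
  | more a ih _ => rw [zpow, mul_assoc, ih, ← mul_assoc, hYY, mul_assoc]

include hXX hXY in
theorem zpow_mul_X (i j : S) (a : ℕ) : zpow X Y i a * X j = (-1 : k) ^ a • (X j * zpow X Y i a) := by
  induction a using Nat.twoStepInduction with
  | zero => simp [zpow]
  | one => simp [zpow, hXX i j]
  | more a ih _ =>
    rw [zpow, mul_assoc, ih, mul_smul_comm, ← mul_assoc, ← hXY, mul_assoc, pow_add]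
    simp

include hXX hXY hYY in
theorem zpow_mul_zpow_comm (i j : S) (a b : ℕ) :
    zpow X Y i a * zpow X Y j b = (-1 : k) ^ (a * b) • (zpow X Y j b * zpow X Y i a) := by
  induction b using Nat.twoStepInduction with
  | zero => simp [zpow]
  | one => rw [zpow, zpow_mul_X (k := k) hXX hXY, mul_one]
  | more b ih _ =>
    rw [zpow, ← mul_assoc, zpow_mul_Y hXY hYY, mul_assoc, ih, mul_smul_comm, mul_assoc, mul_add,
      pow_add, pow_mul' _ a 2]
    simp

include hXY hsq in
open Classical in
theorem zpow_mul_zpow (i : S) (a b : ℕ) :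
    zpow X Y i a * zpow X Y i b = (if Odd (a * b) then n i else 1) • zpow X Y i (a + b) := by
  induction a using Nat.twoStepInduction with
  | zero => simp [zpow]
  | one =>
    induction b using Nat.twoStepInduction with
    | zero => simp [zpow]
    | one => simp [zpow, hsq]
    | more b ih _ =>
      have e : zpow X Y i 1 * zpow X Y i (b + 2) = Y i * (zpow X Y i 1 * zpow X Y i b) := by
        rw [zpow, zpow, ← mul_assoc, hXY, mul_assoc]
      rw [e, ih, mul_smul_comm]
      simp [zpow, Nat.odd_add]
  | more a ih _ =>
    rw [zpow, mul_assoc, ih, mul_smul_comm, show a + 2 + b = a + b + 2 by ring]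
    congr 1
    simp [add_mul, Nat.odd_add]

include hXX hXY hYY in
theorem zprod_mul_zpow (e : S → ℕ) (L : List S) (i : S) (b : ℕ) :
    zprod X Y e L * zpow X Y i b =
      (-1 : k) ^ ((L.map e).sum * b) • (zpow X Y i b * zprod X Y e L) := by
  induction L with
  | nil => simp [zprod]
  | cons j L ih =>
    simp only [zprod, List.map_cons, List.prod_cons, List.sum_cons] at ih ⊢
    rw [mul_assoc, ih, mul_smul_comm, ← mul_assoc, zpow_mul_zpow_comm hXX hXY hYY (k := k) j i,
      smul_mul_assoc, smul_smul, ← pow_add, mul_assoc]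
    congr 2
    ring

include hXX hXY hYY hsq in
open Classical in
theorem zprod_mul_zprod (e e' : S → ℕ) (L : List S) :
    zprod X Y e L * zprod X Y e' L =
      ((-1 : k) ^ omegaList e e' L *
        (L.map fun i => if Odd (e i * e' i) then n i else 1).prod) • zprod X Y (e + e') L := by
  induction L with
  | nil => simp [zprod, omegaList]
  | cons i L ih =>
    have h1 := zprod_mul_zpow (k := k) hXX hXY hYY e L i (e' i)
    have h2 := zpow_mul_zpow hXY hsq i (e i) (e' i)
    have hc : ∀ e : S → ℕ, zprod X Y e (i :: L) = zpow X Y i (e i) * zprod X Y e L := fun e => by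
      simp [zprod]
    calc zprod X Y e (i :: L) * zprod X Y e' (i :: L)
        = zpow X Y i (e i) * (zprod X Y e L * zpow X Y i (e' i)) * zprod X Y e' L := by
          rw [hc, hc]; simp only [mul_assoc]
      _ = (-1 : k) ^ ((L.map e).sum * e' i) •
            ((zpow X Y i (e i) * zpow X Y i (e' i)) * (zprod X Y e L * zprod X Y e' L)) := by
          rw [h1, mul_smul_comm, smul_mul_assoc]; simp only [mul_assoc]
      _ = _ := by
          rw [h2, ih, hc, smul_mul_smul_comm, smul_smul, omegaList, List.map_cons, List.prod_cons,
            pow_add]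
          congr 1
          ring

theorem sum_filter_lt_eq_omegaList [LinearOrder S] (e e' : S → ℕ) (L : List S)
    (hL : L.Pairwise (· < ·)) :
    ∑ i ∈ L.toFinset, ∑ j ∈ L.toFinset with j < i, e' j * e i = omegaList e e' L := by
  induction L with
  | nil => simp [omegaList]
  | cons a L ih =>
    rw [List.pairwise_cons] at hL
    have ha : a ∉ L.toFinset := fun h => lt_irrefl _ (hL.1 a (by simpa using h))
    have hnd : L.Nodup := hL.2.imp ne_of_lt
    rw [List.toFinset_cons, Finset.sum_insert ha, omegaList, ← ih hL.2, ← List.sum_toFinset _ hnd,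
      Finset.sum_mul, ← Finset.sum_add_distrib]
    have h0 : ∑ j ∈ insert a L.toFinset with j < a, e' j * e a = 0 := by
      refine Finset.sum_eq_zero fun j hj => ?_
      rw [Finset.mem_filter, Finset.mem_insert, List.mem_toFinset] at hj
      rcases hj with ⟨rfl | hj, hlt⟩
      · exact absurd hlt (lt_irrefl _)
      · exact absurd hlt (hL.1 j hj).not_gt
    rw [h0, zero_add]
    refine Finset.sum_congr rfl fun i hi => ?_
    rw [Finset.filter_insert, if_pos (hL.1 i (by simpa using hi)),
      Finset.sum_insert (by simp [ha, -List.mem_toFinset]), mul_comm (e i)]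

end Algebra

end ListCochain

namespace CyclotomicInertia

open NumberField

/-! ### Inertia groups of cyclotomic fields -/

section InertiaExponent

variable {K : Type} [Field K] [NumberField K] {P : Ideal (𝓞 K)} [P.IsPrime] {p : ℕ}
  [P.LiesOver (Ideal.span {(p : ℤ)})]

omit [NumberField K] [P.IsPrime] in
theorem mk_natCast_eq_zero_of_liesOver : Ideal.Quotient.mk P (p : 𝓞 K) = 0 := by
  rw [Ideal.Quotient.eq_zero_iff_mem]
  have h : (p : ℤ) ∈ P.under ℤ := by
    rw [← Ideal.over_def P (Ideal.span {(p : ℤ)})]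
    exact Ideal.mem_span_singleton_self _
  simpa using! h

omit [NumberField K] in
theorem mk_natCast_ne_zero_of_coprime {q : ℕ} (hq : p.Coprime q) :
    Ideal.Quotient.mk P (q : 𝓞 K) ≠ 0 := by
  intro h0
  have hp : Ideal.Quotient.mk P (p : 𝓞 K) = 0 := mk_natCast_eq_zero_of_liesOver
  have h := congrArg (fun n : ℤ => Ideal.Quotient.mk P (n : 𝓞 K)) (Nat.gcd_eq_gcd_ab p q)
  simp only [hq.gcd_eq_one] at h
  push_cast at h
  rw [map_add, map_mul, map_mul, hp, h0, zero_mul, zero_mul, add_zero, map_one] at h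
  exact one_ne_zero h

omit [NumberField K] in
/-- Roots of unity of prime order `q` remain distinct modulo a prime that does not divide `q`: if
`η = 1`, the vanishing geometric sum of the powers of `η` would be equal to `q`. -/
theorem orderOf_mk_eq {q : ℕ} (hq : q.Prime) (hpq : p.Coprime q) {η : 𝓞 K}
    (hη : IsPrimitiveRoot η q) : orderOf (Ideal.Quotient.mk P η) = q := by
  have := Fact.mk hq
  refine orderOf_eq_prime (by rw [← map_pow, hη.pow_eq_one, map_one]) fun h1 => ?_
  have h := congrArg (Ideal.Quotient.mk P) (hη.geom_sum_eq_zero hq.one_lt)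
  rw [map_sum, map_zero] at h
  simp only [map_pow, h1, one_pow, Finset.sum_const, Finset.card_range, nsmul_eq_mul,
    mul_one] at h
  exact mk_natCast_ne_zero_of_coprime (P := P) hpq (by rw [map_natCast]; exact h)

variable {r : ℕ} [NeZero r] [IsCyclotomicExtension {r} ℚ K]

open IsCyclotomicExtension IsCyclotomicExtension.Rat

/-- An element of the inertia group at a prime above `p` fixes the `q`-th roots of unity, since they
remain distinct in the residue field. -/
theorem modEq_one_of_mem_inertia {q : ℕ} (hq : q.Prime) (hqr : q ∣ r) (hpq : p.Coprime q)
    {σ : Gal(K/ℚ)} (hσ : σ ∈ P.inertia Gal(K/ℚ)) :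
    (galEquivZMod r K σ).val.val ≡ 1 [MOD q] := by
  have hζ := (zeta_spec r ℚ K).toInteger_isPrimitiveRoot
  obtain ⟨d, hd⟩ := hqr
  have hη := hζ.pow (NeZero.pos r) (show r = d * q by rw [hd, mul_comm])
  have h := (Ideal.Quotient.eq (I := P)).2 (hσ (((zeta_spec r ℚ K).toInteger) ^ d))
  rw [galEquivZMod_smul_of_pow_eq r K σ (by
    rw [← pow_mul, mul_comm, pow_mul, hζ.pow_eq_one, one_pow]), map_pow] at h
  conv_rhs at h => rw [← pow_one (Ideal.Quotient.mk P _)]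
  have ho := orderOf_mk_eq (P := P) hq hpq hη
  rwa [(orderOf_pos_iff.1 (ho ▸ hq.pos)).pow_eq_pow_iff_modEq, ho] at h

/-- The ring of integers is generated by a root of unity `ζ`, and the `p`-th powers of `σ ζ` and `ζ`
are equal, so that `σ ζ` and `ζ` agree in the residue field, which has characteristic `p`. -/
theorem mem_inertia_of_modEq (hp : p.Prime) {d : ℕ} (hr : r = p * d) {σ : Gal(K/ℚ)}
    (h : (galEquivZMod r K σ).val.val ≡ 1 [MOD d]) : σ ∈ P.inertia Gal(K/ℚ) := by
  have hζ := (zeta_spec r ℚ K).toInteger_isPrimitiveRoot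
  have htop := adjoin_singleton_eq_top (zeta_spec r ℚ K)
  set ζ := (zeta_spec r ℚ K).toInteger with hζ'
  have hchar : Ideal.Quotient.mk P (p : 𝓞 K) = 0 := mk_natCast_eq_zero_of_liesOver
  have : Fact p.Prime := ⟨hp⟩
  have : CharP (𝓞 K ⧸ P) p :=
    ringChar.of_eq (CharP.ringChar_of_prime_eq_zero hp (by rw [← map_natCast (Ideal.Quotient.mk P), hchar]))
  have hgen : Ideal.Quotient.mk P (σ • ζ) = Ideal.Quotient.mk P ζ := by
    rw [galEquivZMod_smul_of_pow_eq r K σ hζ.pow_eq_one]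
    set a := (galEquivZMod r K σ).val.val
    have h1 : ζ ^ (a * p) = ζ ^ p := by
      rw [(hζ.isOfFinOrder (NeZero.ne r)).pow_eq_pow_iff_modEq, ← hζ.eq_orderOf, hr]
      simpa [mul_comm] using h.mul_left' p
    refine frobenius_inj (𝓞 K ⧸ P) p ?_
    rw [frobenius_def, frobenius_def, ← map_pow, ← map_pow, ← pow_mul, h1]
  intro x
  rw [Submodule.mem_toAddSubgroup, ← Ideal.Quotient.eq]
  have hx : x ∈ Algebra.adjoin ℤ {ζ} := htop ▸ Algebra.mem_top
  induction hx using Algebra.adjoin_induction with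
  | mem x hx => rw [Set.mem_singleton_iff.1 hx, hgen]
  | algebraMap n => rw [smul_algebraMap]
  | add x y _ _ hx hy => rw [smul_add, map_add, map_add, hx, hy]
  | mul x y _ _ hx hy => rw [smul_mul', map_mul, map_mul, hx, hy]

end InertiaExponent

theorem gal_comm (r : ℕ) [NeZero r] {K : Type} [Field K] [NumberField K]
    [IsCyclotomicExtension {r} ℚ K] (σ τ : Gal(K/ℚ)) : σ * τ = τ * σ :=
  (IsCyclotomicExtension.Rat.galEquivZMod r K).injective (by rw [map_mul, map_mul, mul_comm])

/-! ### Coordinates of the Galois group -/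

section Characters

variable {S : Type*} [Fintype S] (ℓ : S → ℕ) (hprime : ∀ i, (ℓ i).Prime)

/-- A discrete logarithm modulo a prime, for an arbitrary choice of a primitive root. -/
def dlog {p : ℕ} (hp : p.Prime) : (ZMod p)ˣ ≃* Multiplicative (ZMod (p - 1)) :=
  have : Fact p.Prime := ⟨hp⟩
  mulEquivOfCyclicCardEq (by
    rw [Nat.card_eq_fintype_card, ZMod.card_units]
    exact (Nat.card_zmod (p - 1)).symm)

variable (K : Type) [Field K] [NumberField K] [IsCyclotomicExtension {∏ i, ℓ i} ℚ K]
  [NeZero (∏ i, ℓ i)]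

open IsCyclotomicExtension.Rat

/-- The `i`-th coordinate of the Galois group: the discrete logarithm modulo `ℓ i` of the
cyclotomic character. -/
def coord (i : S) : Gal(K/ℚ) →* Multiplicative (ZMod (ℓ i - 1)) :=
  (dlog (hprime i)).toMonoidHom.comp
    ((ZMod.unitsMap (Finset.dvd_prod_of_mem ℓ (Finset.mem_univ i))).comp
      (galEquivZMod (∏ i, ℓ i) K).toMonoidHom)

variable {ℓ} {K}

theorem coord_eq_one_iff (i : S) (σ : Gal(K/ℚ)) :
    coord ℓ hprime K i σ = 1 ↔ (galEquivZMod (∏ i, ℓ i) K σ).val.val ≡ 1 [MOD ℓ i] := by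
  rw [coord, MonoidHom.comp_apply, MulEquiv.coe_toMonoidHom, EmbeddingLike.map_eq_one_iff,
    MonoidHom.comp_apply, ZMod.unitsMap_def, Units.ext_iff, Units.coe_map, Units.val_one,
    ← ZMod.natCast_eq_natCast_iff, Nat.cast_one]
  simp [ZMod.natCast_val]

variable (hinj : Function.Injective ℓ)

omit [Fintype S] [NeZero (∏ i, ℓ i)] in
include hprime hinj in
theorem pairwise_coprime : Pairwise (Function.onFun Nat.Coprime ℓ) := fun i j hij =>
  (Nat.coprime_primes (hprime i) (hprime j)).2 (hinj.ne hij)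

omit [Fintype S] [NeZero (∏ i, ℓ i)] in
include hprime hinj in
theorem modEq_prod {a : ℕ} (s : Finset S) (h : ∀ i ∈ s, a ≡ 1 [MOD ℓ i]) :
    a ≡ 1 [MOD ∏ i ∈ s, ℓ i] := by
  classical
  induction s using Finset.induction_on with
  | empty => exact Nat.modEq_one
  | insert i s hi ih =>
    rw [Finset.prod_insert hi]
    refine (Nat.modEq_and_modEq_iff_modEq_mul ?_).1
      ⟨h i (by simp), ih fun j hj => h j (by simp [hj])⟩
    exact Nat.Coprime.prod_right fun j hj =>
      pairwise_coprime hprime hinj (by rintro rfl; exact hi hj)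

include hprime hinj in
/-- Together with `exists_coord_eq`: the coordinates identify the Galois group with the product of the
cyclic groups `ℤ/(ℓ i - 1)`. -/
theorem eq_one_of_coord_eq_one {σ : Gal(K/ℚ)} (h : ∀ i, coord ℓ hprime K i σ = 1) : σ = 1 := by
  have h1 := modEq_prod hprime hinj Finset.univ fun i _ => (coord_eq_one_iff hprime i σ).1 (h i)
  rw [← ZMod.natCast_eq_natCast_iff] at h1
  refine (galEquivZMod (∏ i, ℓ i) K).injective (Units.ext ?_)
  rw [map_one, Units.val_one]
  simpa using h1

include hprime hinj in
theorem exists_coord_eq (c : ∀ i, Multiplicative (ZMod (ℓ i - 1))) :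
    ∃ σ : Gal(K/ℚ), ∀ i, coord ℓ hprime K i σ = c i := by
  let e := Units.mapEquiv (ZMod.prodEquivPi ℓ (pairwise_coprime hprime hinj)).toMulEquiv
  refine ⟨(galEquivZMod (∏ i, ℓ i) K).symm
    (e.symm (MulEquiv.piUnits.symm fun i => (dlog (hprime i)).symm (c i))), fun i => ?_⟩
  set u := MulEquiv.piUnits.symm fun i => (dlog (hprime i)).symm (c i) with hu
  have h1 : ZMod.unitsMap (Finset.dvd_prod_of_mem ℓ (Finset.mem_univ i)) (e.symm u) =
      (dlog (hprime i)).symm (c i) := by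
    have h2 : (e (e.symm u)).val i = ((dlog (hprime i)).symm (c i) : ZMod (ℓ i)) := by
      rw [MulEquiv.apply_symm_apply]
      rfl
    ext
    rw [← h2, ZMod.unitsMap_def, Units.coe_map]
    exact (ZMod.prodEquivPi_apply ℓ (pairwise_coprime hprime hinj) _ i).symm
  rw [coord, MonoidHom.comp_apply, MonoidHom.comp_apply, MulEquiv.coe_toMonoidHom,
    MulEquiv.coe_toMonoidHom, MulEquiv.apply_symm_apply, h1, MulEquiv.apply_symm_apply]

variable {P : S → Ideal (𝓞 K)} (hP : ∀ i, (P i).IsPrime)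
    (hPℓ : ∀ i, (P i).LiesOver (Ideal.span {(ℓ i : ℤ)}))

include hprime hinj hP hPℓ in
/-- The inertia group at `ℓ i` is the `i`-th factor of the Galois group. -/
theorem mem_inertia_iff (i : S) (σ : Gal(K/ℚ)) :
    σ ∈ (P i).inertia Gal(K/ℚ) ↔ ∀ j ≠ i, coord ℓ hprime K j σ = 1 := by
  classical
  have := hP i
  have := hPℓ i
  constructor
  · intro h j hj
    rw [coord_eq_one_iff]
    exact modEq_one_of_mem_inertia (hprime j) (Finset.dvd_prod_of_mem ℓ (Finset.mem_univ j))
      (pairwise_coprime hprime hinj hj.symm) h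
  · intro h
    refine mem_inertia_of_modEq (r := ∏ i, ℓ i) (hprime i)
      (Finset.mul_prod_erase _ _ (Finset.mem_univ i)).symm ?_
    exact modEq_prod hprime hinj _ fun j hj =>
      (coord_eq_one_iff hprime j σ).1 (h j (Finset.ne_of_mem_erase hj))

include hprime hinj hP hPℓ in
/-- The subgroup generated by the inertia groups at the `ℓ i`, `i ∈ T`, is the product of the
factors of the Galois group with index in `T`. -/
theorem mem_galT_iff (T : Set S) (σ : Gal(K/ℚ)) :
    σ ∈ galT P T ↔ ∀ j ∉ T, coord ℓ hprime K j σ = 1 := by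
  classical
  constructor
  · intro h j hj
    have : galT P T ≤ (coord ℓ hprime K j).ker := iSup₂_le fun i hi τ hτ =>
      (mem_inertia_iff hprime hinj hP hPℓ i τ).1 hτ j (by rintro rfl; exact hj hi)
    exact this h
  · -- An element is the product of its components, and those outside `T` are trivial.
    suffices key : ∀ (s : Finset S) (τ : Gal(K/ℚ)), (∀ i ∈ s, i ∈ T) →
        (∀ j ∉ s, coord ℓ hprime K j τ = 1) → τ ∈ galT P T by
      intro h
      refine key (Finset.univ.filter (· ∈ T)) σ (by simp) fun j hj => h j (by simpa using hj)
    intro s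
    induction s using Finset.induction_on with
    | empty =>
      intro τ _ hτ
      rw [eq_one_of_coord_eq_one hprime hinj fun i => hτ i (by simp)]
      exact one_mem _
    | insert i s hi ih =>
      intro τ hs hτ
      obtain ⟨ρ, hρ⟩ := exists_coord_eq (K := K) hprime hinj
        (Pi.mulSingle i (coord ℓ hprime K i τ))
      have hmem : ρ ∈ galT P T := by
        refine (le_iSup₂_of_le i (hs i (by simp)) le_rfl :
          (P i).inertia Gal(K/ℚ) ≤ galT P T) ?_
        refine (mem_inertia_iff hprime hinj hP hPℓ i ρ).2 fun j hj => ?_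
        rw [hρ, Pi.mulSingle_eq_of_ne hj]
      have h2 : τ * ρ⁻¹ ∈ galT P T := by
        refine ih _ (fun j hj => hs j (by simp [hj])) fun j hj => ?_
        rw [map_mul, map_inv, hρ]
        by_cases hji : j = i
        · subst hji
          rw [Pi.mulSingle_eq_same, mul_inv_cancel]
        · rw [hτ j (by simp [hji, hj]), Pi.mulSingle_eq_of_ne hji, inv_one, mul_one]
      simpa using mul_mem h2 hmem

end Characters

end CyclotomicInertia

namespace ListCochain

open CupProduct

/-! ### The classes of the monomials -/

section Classes

variable {k G : Type} [CommRing k] [Group G] {S : Type*} {N : S → ℕ} [∀ i, NeZero (N i)]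
  (hN : ∀ i, (N i : k) = 0) (χ : ∀ i, G →* Multiplicative (ZMod (N i)))

/-- The class of a monomial cocycle in the cohomology ring. -/
def monoClass (e : S → ℕ) (L : List S) : HStar k G :=
  clsStar (L.map e).sum (mono χ k e L) (dL_mono χ hN e L)

theorem zpow_mul_clsStar (i : S) (n d : ℕ) {u : List G → k} (hu : dL u = 0) :
    zpow (fun i => cls1 (charX (χ i) k) (charX_mul (χ i) (hN i)))
      (fun i => cls2 (charY (χ i) k) (charY_cocycle (χ i))) i n * clsStar d u hu =
      clsStar (n + d) (power (χ i) n u) (dL_power (χ i) (hN i) n hu) := by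
  induction n using Nat.twoStepInduction with
  | zero =>
    rw [zpow, one_mul]
    exact clsStar_congr _ (zero_add d).symm rfl
  | one =>
    rw [zpow, cls1_mul]
    exact clsStar_congr _ (add_comm d 1) rfl
  | more n ih _ =>
    rw [zpow, mul_assoc, ih, cls2_mul]
    exact clsStar_congr _ (by ring) rfl

/-- The class of a monomial cocycle is the monomial in the classes of the generators. -/
theorem monoClass_eq_zprod (e : S → ℕ) (L : List S) :
    monoClass hN χ e L = zprod (fun i => cls1 (charX (χ i) k) (charX_mul (χ i) (hN i)))
      (fun i => cls2 (charY (χ i) k) (charY_cocycle (χ i))) e L := by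
  induction L with
  | nil => exact clsStar_unitC
  | cons i L ih =>
    rw [zprod, List.map_cons, List.prod_cons]
    refine Eq.trans ?_ (congrArg _ ih)
    refine Eq.trans ?_
      (zpow_mul_clsStar hN χ i (e i) (L.map e).sum (dL_mono χ hN e L)).symm
    exact clsStar_congr _ (by simp) rfl

open Classical in
theorem monoClass_mul {n : S → ℕ} (hn : ∀ i, N i = 2 * n i) (e e' : S → ℕ) (L : List S) :
    monoClass hN χ e L * monoClass hN χ e' L =
      ((-1 : k) ^ omegaList e e' L *
        (L.map fun i => if Odd (e i * e' i) then (n i : k) else 1).prod) •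
        monoClass hN χ (e + e') L := by
  simp only [monoClass_eq_zprod]
  exact zprod_mul_zprod (fun i j => cls1_anticomm _ _) (fun i j => cls1_comm_cls2 _ _)
    (fun i j => cls2_comm _ _) (fun i => cls1_charX_sq (hn i) (hN i) (χ i)) e e' L

theorem resStar_monoClass (K : Subgroup G) (e : S → ℕ) (L : List S) :
    resStar k K (monoClass hN χ e L) = monoClass hN (fun i => (χ i).comp K.subtype) e L := by
  rw [monoClass, clsStar, resStar, DirectSum.lmap_of]
  refine (congrArg _ (res_clsL K _ (dL_mono χ hN e L))).trans ?_
  exact clsStar_congr (dL_pull_subtype K (dL_mono χ hN e L)) rfl (pull_mono χ K.subtype e L)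

theorem monoClass_eq_zero {e : S → ℕ} {L : List S} {i : S} (hi : i ∈ L) (h : χ i = 1)
    (he : e i ≠ 0) : monoClass hN χ e L = 0 := by
  have := mono_eq_zero (k := k) χ e hi h he
  refine (clsStar_congr _ rfl this).trans ?_
  exact (congrArg _ (map_zero (clsL (L.map e).sum))).trans (map_zero _)

variable {χ}

/-- The classes of the monomials of degree `n` form a basis of the cohomology in degree `n`. The
monomials are indexed by a type `E` through `ε`; only the exponents at the indices in `L` matter. -/
theorem exists_basis (hN1 : ∀ i, 1 < N i) {L : List S} (hL : L.Nodup) (h : IsCoordinates χ L)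
    (n : ℕ) {E : Type*} (ε : E → S → ℕ) (hinj : ∀ a b, (∀ j ∈ L, ε a j = ε b j) → a = b)
    (hdeg : ∀ a, (L.map (ε a)).sum = n)
    (hsurj : ∀ e : S → ℕ, (L.map e).sum = n → ∃ a, ∀ j ∈ L, ε a j = e j) :
    ∃ b : Module.Basis E k (H k G n), ∀ a,
      b a = clsL n ⟨mono χ k (ε a) L, (LinearMap.mem_ker).2 (dL_mono χ hN (ε a) L)⟩ := by
  classical
  let v : E → LinearMap.ker (dL (G := G) (k := k)) := fun a =>
    ⟨mono χ k (ε a) L, (LinearMap.mem_ker).2 (dL_mono χ hN (ε a) L)⟩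
  have hli : LinearIndependent k fun a => clsL n (v a) := by
    rw [linearIndependent_iff']
    intro s g hg a ha
    have hsum : clsL n (∑ a ∈ s, g a • v a) = 0 := by simpa using hg
    -- A linear relation between classes is a coboundary, to which the dual functionals apply.
    obtain ⟨m, hm⟩ := exists_dL_eq_of_clsL_eq_zero _ (fun l hl => by
      simp only [Submodule.coe_sum, Submodule.coe_smul, Finset.sum_apply, Pi.smul_apply]
      refine Finset.sum_eq_zero fun b _ => ?_
      rw [show (v b).1 l = 0 from mono_apply_eq_zero χ _ _ _ (by rwa [hdeg]), smul_zero]) hsum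
    obtain ⟨φ, hφ, hφm⟩ := exists_dual hN hN1 (ε a) hL h
    have h1 := congrArg φ hm
    simp only [Submodule.coe_sum, Submodule.coe_smul, map_sum, map_smul, hφ] at h1
    have h2 : ∀ b ∈ s, g b • φ (v b).1 = if b = a then g a else 0 := by
      intro b _
      rw [show φ (v b).1 = _ from hφm (ε b)]
      by_cases hba : b = a
      · simp [hba]
      · rw [if_neg fun hj => hba (hinj a b hj).symm, if_neg hba, smul_zero]
    rwa [Finset.sum_congr rfl h2, Finset.sum_ite_eq' s a, if_pos ha] at h1
  have hspan : ⊤ ≤ Submodule.span k (Set.range fun a => clsL n (v a)) := by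
    intro x _
    obtain ⟨u, -, rfl⟩ := exists_clsL_eq n x
    obtain ⟨w, hw, m, hm⟩ := exists_span hN hN1 hL h (n + 1) ((LinearMap.mem_ker).1 u.2)
    -- In the component of degree `n`, only the monomials of degree `n` contribute.
    have key : ∃ hw0 : dL w = 0, clsL n ⟨w, (LinearMap.mem_ker).2 hw0⟩ ∈
        Submodule.span k (Set.range fun a => clsL n (v a)) := by
      clear hm
      induction hw using Submodule.span_induction with
      | mem w hw =>
        obtain ⟨e, rfl⟩ := hw
        refine ⟨dL_mono χ hN e L, ?_⟩
        by_cases he : (L.map e).sum = n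
        · obtain ⟨a, ha⟩ := hsurj e he
          refine Submodule.subset_span ⟨a, ?_⟩
          simp only [v, mono_congr (χ := χ) (fun _ _ => rfl) ha]
        · rw [clsL_eq_zero _ 0 fun l hl => ?_]
          · exact Submodule.zero_mem _
          · rw [map_zero]
            exact mono_apply_eq_zero χ e L l (by rw [hl]; exact Ne.symm he)
      | zero => exact ⟨map_zero _, by convert Submodule.zero_mem _; exact map_zero (clsL n)⟩
      | add w w' _ _ h1 h2 =>
        obtain ⟨h1, h1'⟩ := h1
        obtain ⟨h2, h2'⟩ := h2
        refine ⟨by rw [map_add, h1, h2, add_zero], ?_⟩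
        have := Submodule.add_mem _ h1' h2'
        rwa [← map_add] at this
      | smul c w _ h1 =>
        obtain ⟨h1, h1'⟩ := h1
        refine ⟨by rw [map_smul, h1, smul_zero], ?_⟩
        have := Submodule.smul_mem _ c h1'
        rwa [← map_smul] at this
    obtain ⟨hw0, hw'⟩ := key
    have hsub := clsL_eq_zero (n := n) (u - ⟨w, (LinearMap.mem_ker).2 hw0⟩) m fun l hl => by
      change u.1 l - w l = _
      rw [hm l (by omega), add_sub_cancel_left]
    rw [map_sub, sub_eq_zero] at hsub
    rwa [hsub]
  exact ⟨Module.Basis.mk hli hspan, fun a => by rw [Module.Basis.mk_apply]⟩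

end Classes

end ListCochain

end

theorem mainTheorem7 {S : Type*} [Fintype S] [LinearOrder S] (ℓ : S → ℕ)
    (hprime : ∀ i, (ℓ i).Prime) (hodd : ∀ i, Odd (ℓ i)) (hinj : Function.Injective ℓ)
    (M : ℕ) (hM : 0 < M) (hdvd : ∀ i, M ∣ ℓ i - 1)
    (K : Type) [Field K] [NumberField K] [IsCyclotomicExtension {∏ i, ℓ i} ℚ K]
    (P : S → Ideal (NumberField.RingOfIntegers K)) (hP : ∀ i, (P i).IsPrime)
    (hPℓ : ∀ i, (P i).LiesOver (Ideal.span {(ℓ i : ℤ)})) :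
    ∃ c : (S → ℕ) → CupProduct.HStar (ZMod M) Gal(K/ℚ),
      (∀ (T : Set S) (n : ℕ),
        ∃ b : Module.Basis {e : S → ℕ // Function.support e ⊆ T ∧ CyclotomicInertia.deg e = n}
            (ZMod M) (CupProduct.H (ZMod M) (CyclotomicInertia.galT P T) n),
          ∀ e, CupProduct.resStar (ZMod M) (CyclotomicInertia.galT P T) (c e.1) =
            DirectSum.of
              (fun m => CupProduct.H (ZMod M) (CyclotomicInertia.galT P T) m) n (b e)) ∧
      (∀ (T : Set S) (e : S → ℕ), ¬ Function.support e ⊆ T →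
        CupProduct.resStar (ZMod M) (CyclotomicInertia.galT P T) (c e) = 0) ∧
      (∀ e e' : S → ℕ,
        CupProduct.cupStar (c e) (c e') =
          ((-1 : ZMod M) ^ CyclotomicInertia.omegaPair e e' *
            ∏ i with Odd (e i * e' i), (((ℓ i - 1) / 2 : ℕ) : ZMod M)) • c (e + e')) ∧
      (∀ (T : Set S) (e e' : S → ℕ),
        CupProduct.cupStar
            (CupProduct.resStar (ZMod M) (CyclotomicInertia.galT P T) (c e))
            (CupProduct.resStar (ZMod M) (CyclotomicInertia.galT P T) (c e')) =
          ((-1 : ZMod M) ^ CyclotomicInertia.omegaPair e e' *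
            ∏ i with Odd (e i * e' i), (((ℓ i - 1) / 2 : ℕ) : ZMod M)) •
            CupProduct.resStar (ZMod M) (CyclotomicInertia.galT P T) (c (e + e'))) := by
  classical
  have hN2 : ∀ i, ℓ i - 1 = 2 * ((ℓ i - 1) / 2) := fun i => by
    obtain ⟨m, hm⟩ := hodd i
    omega
  have hN1 : ∀ i, 1 < ℓ i - 1 := fun i => by
    have h2 := (hprime i).two_le
    obtain ⟨m, hm⟩ := hodd i
    omega
  have hNz : ∀ i, NeZero (ℓ i - 1) := fun i => ⟨(zero_lt_one.trans (hN1 i)).ne'⟩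
  have hr : NeZero (∏ i, ℓ i) := ⟨Finset.prod_ne_zero_iff.2 fun i _ => (hprime i).ne_zero⟩
  have hN : ∀ i, ((ℓ i - 1 : ℕ) : ZMod M) = 0 := fun i => (ZMod.natCast_eq_zero_iff _ _).2 (hdvd i)
  let χ : ∀ i, Gal(K/ℚ) →* Multiplicative (ZMod (ℓ i - 1)) :=
    CyclotomicInertia.coord ℓ hprime K
  -- The factors of the monomials are multiplied in increasing order of the indices.
  let L : List S := Finset.univ.sort (· ≤ ·)
  have hLmem : ∀ i, i ∈ L := fun i => by simp [L]
  have hLnd : L.Nodup := Finset.sort_nodup _ _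
  have hLs : L.Pairwise (· < ·) := Finset.sortedLT_sort _ |>.pairwise
  have hLf : L.toFinset = Finset.univ := by simp [L]
  have hdeg : ∀ e : S → ℕ, (L.map e).sum = CyclotomicInertia.deg e := fun e => by
    rw [← List.sum_toFinset _ hLnd, hLf, CyclotomicInertia.deg]
  have hom : ∀ e e' : S → ℕ,
      ListCochain.omegaList e e' L = CyclotomicInertia.omegaPair e e' := fun e e' => by
    rw [← ListCochain.sum_filter_lt_eq_omegaList e e' L hLs, hLf, CyclotomicInertia.omegaPair]
  have hprod : ∀ e e' : S → ℕ,
      (L.map fun i => if Odd (e i * e' i) then (((ℓ i - 1) / 2 : ℕ) : ZMod M) else 1).prod =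
        ∏ i with Odd (e i * e' i), (((ℓ i - 1) / 2 : ℕ) : ZMod M) := fun e e' => by
    rw [← List.prod_toFinset _ hLnd, hLf, Finset.prod_filter]
  have hT := CyclotomicInertia.mem_galT_iff hprime hinj hP hPℓ
  refine ⟨fun e => ListCochain.monoClass hN χ e L, fun T n => ?_, fun T e he => ?_,
    fun e e' => ?_, fun T e e' => ?_⟩
  · -- The coordinates with index in `T` restrict to coordinates of `galT P T`.
    let LT := L.filter (· ∈ T)
    let χT : ∀ i, CyclotomicInertia.galT P T →* Multiplicative (ZMod (ℓ i - 1)) :=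
      fun i => (χ i).comp (CyclotomicInertia.galT P T).subtype
    have hLT : ∀ i, i ∈ LT ↔ i ∈ T := fun i => by simp [LT, hLmem]
    have hcoord : ListCochain.IsCoordinates χT LT := by
      refine ⟨fun a b => Subtype.ext (CyclotomicInertia.gal_comm (∏ i, ℓ i) _ _),
        fun g hg => Subtype.ext (CyclotomicInertia.eq_one_of_coord_eq_one hprime hinj fun i => ?_),
        fun c => ?_⟩
      · by_cases hi : i ∈ T
        · exact hg i ((hLT i).2 hi)
        · exact (hT T g).1 g.2 i hi
      · obtain ⟨σ, hσ⟩ := CyclotomicInertia.exists_coord_eq (K := K) hprime hinj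
          fun i => if i ∈ T then c i else 1
        refine ⟨⟨σ, (hT T σ).2 fun j hj => by rw [hσ, if_neg hj]⟩, fun i hi => ?_⟩
        refine (hσ i).trans (if_pos ((hLT i).1 hi))
    have hmono : ∀ e : S → ℕ, Function.support e ⊆ T →
        ListCochain.mono χT (ZMod M) e LT = ListCochain.mono χT (ZMod M) e L := fun e he =>
      ListCochain.mono_filter χT e _ L fun i _ hi => by
        by_contra h0
        exact (by simpa using hi : i ∉ T) (he h0)
    have hdegT : ∀ e : S → ℕ, Function.support e ⊆ T →
        (LT.map e).sum = CyclotomicInertia.deg e := fun e he => by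
      rw [← List.sum_toFinset _ (hLnd.filter _), CyclotomicInertia.deg]
      refine Finset.sum_subset (Finset.subset_univ _) fun i _ hi => ?_
      by_contra h0
      exact hi (List.mem_toFinset.2 ((hLT i).2 (he h0)))
    obtain ⟨b, hb⟩ := ListCochain.exists_basis hN hN1 (hLnd.filter _) hcoord n
      (E := {e : S → ℕ // Function.support e ⊆ T ∧ CyclotomicInertia.deg e = n})
      (fun e => e.1)
      (fun a a' h => Subtype.ext (funext fun i => by
        by_cases hi : i ∈ T
        · exact h i ((hLT i).2 hi)
        · rw [Function.notMem_support.1 fun h => hi (a.2.1 h),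
            Function.notMem_support.1 fun h => hi (a'.2.1 h)]))
      (fun a => (hdegT _ a.2.1).trans a.2.2)
      (fun e he => by
        have hs : (Function.support fun i => if i ∈ T then e i else 0) ⊆ T := fun i hi => by
          by_contra h0
          exact hi (if_neg h0)
        have hj : ∀ j ∈ LT, (if j ∈ T then e j else 0) = e j := fun j hj => if_pos ((hLT j).1 hj)
        refine ⟨⟨fun i => if i ∈ T then e i else 0, hs, ?_⟩, hj⟩
        rw [← hdegT _ hs, ← he]
        exact congrArg List.sum (List.map_congr_left hj))
    refine ⟨b, fun e => ?_⟩
    rw [ListCochain.resStar_monoClass, hb]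
    refine (ListCochain.clsStar_congr (n' := n) _ ?_ (hmono e.1 e.2.1).symm)
    rw [hdeg, e.2.2]
  · obtain ⟨i, hi, hiT⟩ := Set.not_subset.1 he
    rw [ListCochain.resStar_monoClass]
    refine ListCochain.monoClass_eq_zero hN _ (hLmem i) ?_ hi
    ext g
    exact (hT T g).1 g.2 i hiT
  · refine (ListCochain.monoClass_mul hN χ hN2 e e' L).trans ?_
    rw [hom, hprod]
  · rw [ListCochain.resStar_monoClass, ListCochain.resStar_monoClass,
      ListCochain.resStar_monoClass]
    refine (ListCochain.monoClass_mul hN _ hN2 e e' L).trans ?_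
    rw [hom, hprod]
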